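/- Let $\mathcal G$ be a simple graph with countable vertex set $I$, all of whose vertices are regarded as odd isotropic. Let $F$ be the free associative complex superalgebra on odd generators $e_i$ ($i\in I$), a Lie superalgebra under the supercommutator, let $\mathcal F\subseteq F$ be the Lie sub-superalgebra generated by the $e_i$ (the free Lie superalgebra), and let $\mathcal P(\mathcal G)$ be the quotient of $\mathcal F$ by the ideal generated by the $[e_i,e_j]$ with $i\ne j$ non-adjacent and by the $[e_i,e_i]$, $i\in I$. Let $\mathbf U_{\mathcal G}$ be the universal enveloping algebra of $\mathcal P(\mathcal G)$, with the $\mathbb Z_+^I$-grading induced by giving $e_i$ the $i$-th unit vector as degree. Let $W_{\mathcal G}$ be the right-angled Coxeter group with generators $s_i$ ($i\in I$) and relations $s_i^2=1$, and $s_is_j=s_js_i$ for non-adjacent $i,j$; let $e(w)$, $w\in W_{\mathcal G}$, be the standard basis of $\mathbb C[W_{\mathcal G}]$, and put $\mathbf x(w)=x_{i_1}\cdots x_{i_k}$ if $w=s_{i_1}\cdots s_{i_k}$ is a reduced expression. Grade $\mathbb C[W_{\mathcal G}]$ as a vector space by letting $e(w)$ have as degree the exponent of $\mathbf x(w)$.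 Fix a total order on $I$. Let $\mathcal M(\mathcal G)$ be the monoid of words in $I$ modulo the commutations $ab\sim ba$ for non-adjacent $a,b$, and let $\mathcal M'(\mathcal G)$ be the set of classes $m$ such that, whenever $m=m_1m_2$ in $\mathcal M(\mathcal G)$, $m_2$ is not of the form $i^ku$ with $i\in I$, $k\ge2$, $u\in\mathcal M(\mathcal G)$. For a class $m$ let $w_{\max}(m)$ be its lexicographically largest word. **Theorem.** 1. The elements $e_{i_1}\cdots e_{i_k}$, where $i_1\cdots i_k=w_{\max}(m)$ and $m$ runs over $\mathcal M'(\mathcal G)$, form a basis of $\mathbf U_{\mathcal G}$, and the linear map which sends each such basis element $e_{i_1}\cdots e_{i_k}$ to $e(s_{i_1})\cdots e(s_{i_k})$ is a vector space isomorphism $\mathbf U_{\mathcal G}\to\mathbb C[W_{\mathcal G}]$ that maps, for every $\mu\in\mathbb Z_+^I$, the graded piece of degree $\mu$ onto the graded piece of degree $\mu$. 2. The monomial $\mathbf x(w)$ does not depend on the reduced expression of $w$, and in $\mathbb C[[x_i:i\in I]]$ $$\sum_{w\in W_{\mathcal G}}\mathbf x(w)=\frac1{I(\mathcal G,-\mathbf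 x)}=\Bigl(\sum_{S}\ \prod_{i\in S}\frac{-x_i}{1+x_i}\Bigr)^{-1},$$ where $S$ runs over the finite independent subsets of $I$ and $I(\mathcal G,\mathbf x)=\sum_U\prod_{i}x_i^{m_i(U)}$ is the sum over all finite multi-subsets $U$ of $I$ whose underlying set is independent, $m_i(U)$ being the multiplicity of $i$ in $U$. (In both infinite sums, each monomial occurs in only finitely many terms.) -/

import Mathlib

noncomputable section

/-! ### Lie superalgebras over `ℂ` -/

/-- The sign `(-1)^{pq}` for parities `p, q`. -/
def superSign (p q : ZMod 2) : ℂ := (-1) ^ (p.val * q.val)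

theorem superSign_comm (p q : ZMod 2) : superSign p q = superSign q p := by
  simp [superSign, mul_comm]

theorem superSign_add (p q r : ZMod 2) :
    superSign p (q + r) = superSign p q * superSign p r := by
  simp only [superSign, ZMod.val_add, pow_mul']
  rw [← neg_one_pow_eq_pow_mod_two, pow_add, mul_pow]

/-- A Lie superalgebra structure on a complex vector space `L`: a decomposition
`L = L₀ ⊕ L₁` and an even bilinear bracket which is super skew-symmetric and satisfies the
super Jacobi identity on homogeneous elements. -/
structure LieSuperalgebra (L : Type*) [AddCommGroup L] [Module ℂ L] where
  part : ZMod 2 → Submodule ℂ L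
  isCompl : IsCompl (part 0) (part 1)
  bracket : L →ₗ[ℂ] L →ₗ[ℂ] L
  bracket_mem : ∀ {p q : ZMod 2} {x y : L}, x ∈ part p → y ∈ part q →
    bracket x y ∈ part (p + q)
  skew : ∀ {p q : ZMod 2} {x y : L}, x ∈ part p → y ∈ part q →
    bracket x y = -(superSign p q • bracket y x)
  jacobi : ∀ {p q : ZMod 2} {x y : L} (z : L), x ∈ part p → y ∈ part q →
    bracket x (bracket y z) = bracket (bracket x y) z + superSign p q • bracket y (bracket x z)

namespace LieSuperalgebra

variable {L : Type*} [AddCommGroup L] [Module ℂ L] (g : LieSuperalgebra L)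

/-- A graded subspace: it contains the homogeneous components of its elements. -/
def IsGraded (N : Submodule ℂ L) : Prop :=
  ∀ x ∈ g.part 0, ∀ y ∈ g.part 1, x + y ∈ N → x ∈ N ∧ y ∈ N

/-- A Lie sub-superalgebra: a graded subspace closed under the bracket. -/
structure IsSub (N : Submodule ℂ L) : Prop where
  graded : g.IsGraded N
  closed : ∀ x ∈ N, ∀ y ∈ N, g.bracket x y ∈ N

/-- An ideal: a graded subspace `N` with `[L, N] ⊆ N` and `[N, L] ⊆ N`. -/
structure IsIdeal (N : Submodule ℂ L) : Prop where
  graded : g.IsGraded N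
  left : ∀ x, ∀ y ∈ N, g.bracket x y ∈ N
  right : ∀ x ∈ N, ∀ y, g.bracket x y ∈ N

/-- The Lie sub-superalgebra generated by a set. -/
def subSpan (S : Set L) : Submodule ℂ L := sInf {N | S ⊆ N ∧ g.IsSub N}

/-- The ideal generated by a set. -/
def idealSpan (S : Set L) : Submodule ℂ L := sInf {N | S ⊆ N ∧ g.IsIdeal N}

theorem subset_subSpan (S : Set L) : S ⊆ g.subSpan S := by
  intro x hx
  simp only [subSpan, SetLike.mem_coe, Submodule.mem_sInf]
  exact fun N hN => hN.1 hx

theorem isSub_subSpan (S : Set L) : g.IsSub (g.subSpan S) := by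
  constructor
  · intro x hx y hy h
    simp only [subSpan, Submodule.mem_sInf] at h ⊢
    exact ⟨fun N hN => (hN.2.graded x hx y hy (h N hN)).1,
      fun N hN => (hN.2.graded x hx y hy (h N hN)).2⟩
  · intro x hx y hy
    simp only [subSpan, Submodule.mem_sInf] at hx hy ⊢
    exact fun N hN => hN.2.closed x (hx N hN) y (hy N hN)

theorem isIdeal_idealSpan (S : Set L) : g.IsIdeal (g.idealSpan S) := by
  refine ⟨?_, ?_, ?_⟩
  · intro x hx y hy h
    simp only [idealSpan, Submodule.mem_sInf] at h ⊢
    exact ⟨fun N hN => (hN.2.graded x hx y hy (h N hN)).1,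
      fun N hN => (hN.2.graded x hx y hy (h N hN)).2⟩
  · intro x y hy
    simp only [idealSpan, Submodule.mem_sInf] at hy ⊢
    exact fun N hN => hN.2.left x y (hy N hN)
  · intro x hx y
    simp only [idealSpan, Submodule.mem_sInf] at hx ⊢
    exact fun N hN => hN.2.right x (hx N hN) y

theorem exists_add (x : L) : ∃ a ∈ g.part 0, ∃ b ∈ g.part 1, a + b = x := by
  have h : x ∈ g.part 0 ⊔ g.part 1 := by rw [g.isCompl.sup_eq_top]; trivial
  exact Submodule.mem_sup.1 h

/-- A Lie sub-superalgebra is a Lie superalgebra. -/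
def restrict (N : Submodule ℂ L) (hN : g.IsSub N) : LieSuperalgebra N where
  part p := (g.part p).comap N.subtype
  isCompl := by
    constructor
    · rw [Submodule.disjoint_def]
      intro x hx hy
      exact Subtype.ext (Submodule.disjoint_def.1 g.isCompl.disjoint x hx hy)
    · rw [codisjoint_iff, eq_top_iff]
      rintro ⟨x, hx⟩ -
      obtain ⟨a, ha, b, hb, rfl⟩ := g.exists_add x
      obtain ⟨ha', hb'⟩ := hN.graded a ha b hb hx
      exact Submodule.mem_sup.2 ⟨⟨a, ha'⟩, ha, ⟨b, hb'⟩, hb, rfl⟩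
  bracket := LinearMap.mk₂ ℂ (fun x y => ⟨g.bracket x y, hN.closed x x.2 y y.2⟩)
    (by intros; ext; simp) (by intros; ext; simp) (by intros; ext; simp) (by intros; ext; simp)
  bracket_mem hx hy := g.bracket_mem hx hy
  skew hx hy := Subtype.ext (g.skew hx hy)
  jacobi z hx hy := Subtype.ext (g.jacobi z hx hy)

/-- The quotient of a Lie superalgebra by an ideal. -/
def quotient (J : Submodule ℂ L) (hJ : g.IsIdeal J) : LieSuperalgebra (L ⧸ J) where
  part p := (g.part p).map J.mkQ
  isCompl := by
    constructor
    · rw [Submodule.disjoint_def]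
      rintro _ ⟨a, ha, rfl⟩ ⟨b, hb, hab⟩
      have h : a + -b ∈ J := by
        rw [← sub_eq_add_neg]
        exact (Submodule.Quotient.eq J).1 hab.symm
      exact (Submodule.Quotient.mk_eq_zero J).2
        (hJ.graded a ha (-b) ((g.part 1).neg_mem hb) h).1
    · rw [codisjoint_iff, eq_top_iff]
      intro x _
      obtain ⟨x, rfl⟩ := J.mkQ_surjective x
      obtain ⟨a, ha, b, hb, rfl⟩ := g.exists_add x
      exact Submodule.mem_sup.2 ⟨_, ⟨a, ha, rfl⟩, _, ⟨b, hb, rfl⟩, (map_add _ _ _).symm⟩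
  bracket := J.liftQ
    (LinearMap.mk₂ ℂ (fun x (y : L ⧸ J) => J.mapQ J (g.bracket x) (fun z hz => hJ.left x z hz) y)
      (by
        intro a b y
        obtain ⟨y, rfl⟩ := J.mkQ_surjective y
        simp)
      (by
        intro c a y
        obtain ⟨y, rfl⟩ := J.mkQ_surjective y
        simp)
      (by intros; simp) (by intros; simp))
    (by
      intro x hx
      rw [LinearMap.mem_ker]
      ext y
      simpa using hJ.right x hx y)
  bracket_mem := by
    rintro p q _ _ ⟨a, ha, rfl⟩ ⟨b, hb, rfl⟩
    exact ⟨_, g.bracket_mem ha hb, by simp⟩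
  skew := by
    rintro p q _ _ ⟨a, ha, rfl⟩ ⟨b, hb, rfl⟩
    have h := congrArg J.mkQ (g.skew ha hb)
    simpa using h
  jacobi := by
    rintro p q _ _ z ⟨a, ha, rfl⟩ ⟨b, hb, rfl⟩
    obtain ⟨z, rfl⟩ := J.mkQ_surjective z
    have h := congrArg J.mkQ (g.jacobi z ha hb)
    simpa using h

/-- The relations `[x, y] = x ⊗ y - (-1)^{|x||y|} y ⊗ x` for homogeneous `x, y`. -/
inductive EnvRel : TensorAlgebra ℂ L → TensorAlgebra ℂ L → Prop
  | bracket {p q : ZMod 2} {x y : L} (hx : x ∈ g.part p) (hy : y ∈ g.part q) :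
      EnvRel (TensorAlgebra.ι ℂ (g.bracket x y))
        (TensorAlgebra.ι ℂ x * TensorAlgebra.ι ℂ y
          - superSign p q • (TensorAlgebra.ι ℂ y * TensorAlgebra.ι ℂ x))

/-- The universal enveloping algebra: the tensor algebra modulo the two-sided ideal generated
by the relations above. -/
abbrev Env : Type _ := RingQuot g.EnvRel

/-- The canonical map of a Lie superalgebra to its universal enveloping algebra. -/
def envι : L →ₗ[ℂ] g.Env :=
  (RingQuot.mkAlgHom ℂ g.EnvRel).toLinearMap ∘ₗ TensorAlgebra.ι ℂ

end LieSuperalgebra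

/-! ### Associative superalgebras as Lie superalgebras -/

section AssocSuper

variable {A : Type*} [Ring A] [Algebra ℂ A] (𝒜 : ZMod 2 → Submodule ℂ A) [GradedAlgebra 𝒜]

/-- The supercommutator: the bilinear extension of `[a, b] = a b - (-1)^{|a||b|} b a`. -/
def superCommutator : A →ₗ[ℂ] A →ₗ[ℂ] A :=
  ∑ p : ZMod 2, ∑ q : ZMod 2,
    ((LinearMap.mul ℂ A).compl₁₂ (GradedAlgebra.proj 𝒜 p) (GradedAlgebra.proj 𝒜 q)
      - superSign p q •
        (LinearMap.mul ℂ A).flip.compl₁₂ (GradedAlgebra.proj 𝒜 p) (GradedAlgebra.proj 𝒜 q))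

theorem superCommutator_apply {p q : ZMod 2} {a b : A} (ha : a ∈ 𝒜 p) (hb : b ∈ 𝒜 q) :
    superCommutator 𝒜 a b = a * b - superSign p q • (b * a) := by
  have key : ∀ (p r : ZMod 2) (x : A), x ∈ 𝒜 p →
      GradedAlgebra.proj 𝒜 r x = if p = r then x else 0 := by
    intro p r x hx
    rw [GradedAlgebra.proj_apply, DirectSum.decompose_of_mem 𝒜 hx, DirectSum.coe_of_apply]
    split_ifs <;> simp
  simp only [superCommutator, LinearMap.sum_apply, LinearMap.sub_apply, LinearMap.smul_apply,
    LinearMap.compl₁₂_apply, LinearMap.mul_apply', LinearMap.flip_apply, key p _ a ha,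
    key q _ b hb]
  rw [Finset.sum_eq_single p, Finset.sum_eq_single q]
  · simp
  · intro r _ hr; simp [hr.symm]
  · simp
  · intro r _ hr; simp [hr.symm]
  · simp

/-- An associative superalgebra with the supercommutator is a Lie superalgebra. -/
def assocLieSuperalgebra : LieSuperalgebra A where
  part := 𝒜
  isCompl := by
    have h := DirectSum.Decomposition.isInternal 𝒜
    exact h.isCompl (i := 0) (j := 1) (by decide) (by
      symm
      rw [Set.eq_univ_iff_forall]
      intro x
      fin_cases x
      · exact Or.inl rfl
      · exact Or.inr rfl)
  bracket := superCommutator 𝒜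
  bracket_mem := by
    intro p q x y hx hy
    rw [superCommutator_apply 𝒜 hx hy]
    refine Submodule.sub_mem _ (SetLike.mul_mem_graded hx hy) (Submodule.smul_mem _ _ ?_)
    rw [add_comm]
    exact SetLike.mul_mem_graded hy hx
  skew := by
    intro p q x y hx hy
    rw [superCommutator_apply 𝒜 hx hy, superCommutator_apply 𝒜 hy hx]
    have hs : superSign q p = superSign p q := superSign_comm q p
    have h1 : superSign p q * superSign p q = 1 := by
      simp [superSign, ← mul_pow]
    rw [hs, smul_sub, smul_smul, h1, one_smul]
    abel
  jacobi := by
    intro p q x y z hx hy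
    have hxy := SetLike.mul_mem_graded hx hy
    have hyx : y * x ∈ 𝒜 (p + q) := by
      rw [add_comm]; exact SetLike.mul_mem_graded hy hx
    have hbr : x * y - superSign p q • (y * x) ∈ 𝒜 (p + q) :=
      Submodule.sub_mem _ hxy (Submodule.smul_mem _ _ hyx)
    have hom : ∀ (r : ZMod 2) (z : A), z ∈ 𝒜 r →
        superCommutator 𝒜 x (superCommutator 𝒜 y z) =
          superCommutator 𝒜 (superCommutator 𝒜 x y) z
            + superSign p q • superCommutator 𝒜 y (superCommutator 𝒜 x z) := by
      intro r z hz
      have hyz : y * z - superSign q r • (z * y) ∈ 𝒜 (q + r) := by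
        refine Submodule.sub_mem _ (SetLike.mul_mem_graded hy hz) (Submodule.smul_mem _ _ ?_)
        rw [add_comm]; exact SetLike.mul_mem_graded hz hy
      have hxz : x * z - superSign p r • (z * x) ∈ 𝒜 (p + r) := by
        refine Submodule.sub_mem _ (SetLike.mul_mem_graded hx hz) (Submodule.smul_mem _ _ ?_)
        rw [add_comm]; exact SetLike.mul_mem_graded hz hx
      rw [superCommutator_apply 𝒜 hy hz, superCommutator_apply 𝒜 hx hz,
        superCommutator_apply 𝒜 hx hy, superCommutator_apply 𝒜 hx hyz,
        superCommutator_apply 𝒜 hy hxz, superCommutator_apply 𝒜 hbr hz]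
      have e1 : superSign p (q + r) = superSign p q * superSign p r := by
        exact superSign_add p q r
      have e2 : superSign q (p + r) = superSign p q * superSign q r := by
        rw [superSign_add, superSign_comm q p]
      have e3 : superSign (p + q) r = superSign p r * superSign q r := by
        rw [superSign_comm, superSign_add, superSign_comm r p, superSign_comm r q]
      have h1 : superSign p q * superSign p q = 1 := by simp [superSign, ← mul_pow]
      rw [e1, e2, e3]
      simp only [mul_sub, sub_mul, smul_sub, smul_smul, mul_smul_comm, smul_mul_assoc, mul_assoc]
      have h2 : superSign p q * (superSign p q * superSign q r) = superSign q r := by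
        rw [← mul_assoc, h1, one_mul]
      have h3 : superSign p q * (superSign p q * (superSign q r * superSign p r)) =
          superSign p r * superSign q r := by
        rw [← mul_assoc, h1, one_mul, mul_comm]
      simp only [h2, h3]
      module
    classical
    rw [← DirectSum.sum_support_decompose 𝒜 z]
    simp only [map_sum, Finset.smul_sum, ← Finset.sum_add_distrib]
    exact Finset.sum_congr rfl fun r _ => hom r _ (SetLike.coe_mem _)

end AssocSuper

/-! ### Gradings of the free associative algebra -/

section FreeGrading

variable {I M : Type*} [AddCommMonoid M]

/-- For a weight `d : I → M` of the generators, the span of all words of weight `m`. -/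
def freeAlgebraPart (d : I → M) (m : M) : Submodule ℂ (FreeAlgebra ℂ I) :=
  Submodule.span ℂ {a | ∃ w : List I, (w.map d).sum = m ∧ a = (w.map (FreeAlgebra.ι ℂ)).prod}

instance freeAlgebraPart_gradedMonoid (d : I → M) :
    SetLike.GradedMonoid (freeAlgebraPart d) where
  one_mem := Submodule.subset_span ⟨[], by simp, by simp⟩
  mul_mem := by
    intro m n a b ha hb
    refine Submodule.span_induction₂ (p := fun a b _ _ => a * b ∈ freeAlgebraPart d (m + n))
      ?_ ?_ ?_ ?_ ?_ ?_ ?_ ha hb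
    · rintro _ _ ⟨v, rfl, rfl⟩ ⟨w, rfl, rfl⟩
      exact Submodule.subset_span ⟨v ++ w, by simp, by simp⟩
    · intros; simp
    · intros; simp
    · intro x y z _ _ _ h1 h2; rw [add_mul]; exact add_mem h1 h2
    · intro x y z _ _ _ h1 h2; rw [mul_add]; exact add_mem h1 h2
    · intro r x y _ _ h; rw [smul_mul_assoc]; exact Submodule.smul_mem _ r h
    · intro r x y _ _ h; rw [mul_smul_comm]; exact Submodule.smul_mem _ r h

theorem ι_mem_freeAlgebraPart (d : I → M) (i : I) :
    FreeAlgebra.ι ℂ i ∈ freeAlgebraPart d (d i) :=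
  Submodule.subset_span ⟨[i], by simp, by simp⟩

instance freeAlgebraPart_gradedAlgebra [DecidableEq M] (d : I → M) :
    GradedAlgebra (freeAlgebraPart d) :=
  GradedAlgebra.ofAlgHom (freeAlgebraPart d)
    (FreeAlgebra.lift ℂ fun i =>
      DirectSum.of (fun m => freeAlgebraPart d m) (d i)
        ⟨FreeAlgebra.ι ℂ i, ι_mem_freeAlgebraPart d i⟩)
    (by
      ext i
      simp)
    (by
      have word : ∀ w : List I, ∀ (m : M) (hm : (w.map d).sum = m)
          (h : (w.map (FreeAlgebra.ι ℂ)).prod ∈ freeAlgebraPart d m),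
          FreeAlgebra.lift ℂ (fun i =>
            DirectSum.of (fun m => freeAlgebraPart d m) (d i)
              ⟨FreeAlgebra.ι ℂ i, ι_mem_freeAlgebraPart d i⟩) (w.map (FreeAlgebra.ι ℂ)).prod =
          DirectSum.of (fun m => freeAlgebraPart d m) m ⟨_, h⟩ := by
        intro w
        induction w with
        | nil =>
          rintro m rfl h
          simp only [List.map_nil, List.prod_nil, map_one]
          rfl
        | cons i w ih =>
          rintro m rfl h
          have hw : (w.map (FreeAlgebra.ι ℂ)).prod ∈ freeAlgebraPart d (w.map d).sum :=
            Submodule.subset_span ⟨w, rfl, rfl⟩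
          simp only [List.map_cons, List.prod_cons, map_mul, FreeAlgebra.lift_ι_apply]
          rw [ih _ rfl hw, DirectSum.of_mul_of]
          exact DirectSum.of_eq_of_gradedMonoid_eq
            (Sigma.subtype_ext (List.sum_cons (l := w.map d)).symm rfl)
      rintro m ⟨x, hx⟩
      induction hx using Submodule.span_induction with
      | mem x h =>
        obtain ⟨w, hm, rfl⟩ := h
        exact word w m hm _
      | zero =>
        have : (⟨0, Submodule.zero_mem _⟩ : freeAlgebraPart d m) = 0 := rfl
        rw [this]; simp
      | add x y hx hy h1 h2 =>
        have : (⟨x + y, Submodule.add_mem _ hx hy⟩ : freeAlgebraPart d m) =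
          ⟨x, hx⟩ + ⟨y, hy⟩ := rfl
        rw [this, map_add, ← h1, ← h2, ← map_add]; rfl
      | smul c x hx h =>
        have e : (⟨c • x, Submodule.smul_mem _ c hx⟩ : freeAlgebraPart d m) =
          c • ⟨x, hx⟩ := rfl
        rw [e, ← DirectSum.lof_eq_of ℂ, map_smul, DirectSum.lof_eq_of, ← h, ← map_smul]; rfl)

end FreeGrading

/-! ### Marked graphs and partially commutative Lie superalgebras -/

/-- A simple graph with sets of odd and of odd isotropic vertices. -/
structure MarkedGraph (I : Type*) where
  graph : SimpleGraph I
  odd : Set I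
  isotropic : Set I
  isotropic_subset : isotropic ⊆ odd

namespace MarkedGraph

variable {I : Type*} (G : MarkedGraph I)

open Classical in
/-- The parity of a vertex. -/
def parity (i : I) : ZMod 2 := if i ∈ G.odd then 1 else 0

/-- The free associative superalgebra on the vertices, as a Lie superalgebra. -/
def freeAssoc : LieSuperalgebra (FreeAlgebra ℂ I) :=
  assocLieSuperalgebra (freeAlgebraPart G.parity)

/-- The underlying space of the free Lie superalgebra: the Lie sub-superalgebra of the free
associative superalgebra generated by the generators. -/
def freeLieCarrier : Submodule ℂ (FreeAlgebra ℂ I) :=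
  G.freeAssoc.subSpan (Set.range (FreeAlgebra.ι ℂ))

/-- The free Lie superalgebra on the vertices. -/
def freeLie : LieSuperalgebra G.freeLieCarrier :=
  G.freeAssoc.restrict G.freeLieCarrier (G.freeAssoc.isSub_subSpan _)

/-- The generators of the free Lie superalgebra. -/
def freeGen (i : I) : G.freeLieCarrier :=
  ⟨FreeAlgebra.ι ℂ i, G.freeAssoc.subset_subSpan _ ⟨i, rfl⟩⟩

/-- The defining ideal: it is generated by `[e_i, e_j]` for distinct non-adjacent `i, j` and by
`[e_i, e_i]` for odd isotropic `i`. -/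
def pclsaIdeal : Submodule ℂ G.freeLieCarrier :=
  G.freeLie.idealSpan
    ({x | ∃ i j, i ≠ j ∧ ¬ G.graph.Adj i j ∧ x = G.freeLie.bracket (G.freeGen i) (G.freeGen j)} ∪
      {x | ∃ i ∈ G.isotropic, x = G.freeLie.bracket (G.freeGen i) (G.freeGen i)})

/-- The underlying space of the free partially commutative Lie superalgebra. -/
abbrev Pclsa : Type _ := G.freeLieCarrier ⧸ G.pclsaIdeal

/-- The free partially commutative Lie superalgebra of a marked graph. -/
def pclsa : LieSuperalgebra G.Pclsa :=
  G.freeLie.quotient G.pclsaIdeal (G.freeLie.isIdeal_idealSpan _)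

/-- The universal enveloping algebra of the free partially commutative Lie superalgebra. -/
abbrev U : Type _ := G.pclsa.Env

/-- The generator `e_i` of the universal enveloping algebra. -/
def e (i : I) : G.U := G.pclsa.envι (G.pclsaIdeal.mkQ (G.freeGen i))

/-- The graded piece of degree `μ` of the free partially commutative Lie superalgebra, where
`e_i` has degree the `i`-th unit vector. -/
def pclsaPart (μ : I →₀ ℕ) : Submodule ℂ G.Pclsa :=
  ((freeAlgebraPart (fun i : I => Finsupp.single i 1) μ).comap
    G.freeLieCarrier.subtype).map G.pclsaIdeal.mkQ

/-- The induced graded piece of degree `μ` of the universal enveloping algebra: the span of the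
products of homogeneous elements whose degrees add up to `μ`. -/
def uPart (μ : I →₀ ℕ) : Submodule ℂ G.U :=
  Submodule.span ℂ {a | ∃ l : List ((I →₀ ℕ) × G.Pclsa),
    (∀ t ∈ l, t.2 ∈ G.pclsaPart t.1) ∧ (l.map Prod.fst).sum = μ ∧
      a = (l.map fun t => G.pclsa.envι t.2).prod}

/-! ### The Cartier-Foata monoid -/

/-- The Cartier-Foata monoid: words in the vertices modulo the commutation of non-adjacent
letters. -/
abbrev CartierFoata : Type _ :=
  (conGen fun u v : FreeMonoid I => ∃ a b, ¬ G.graph.Adj a b ∧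
    u = FreeMonoid.of a * FreeMonoid.of b ∧ v = FreeMonoid.of b * FreeMonoid.of a).Quotient

/-- The class of a word. -/
def cls (w : List I) : G.CartierFoata := ((FreeMonoid.ofList w : FreeMonoid I) : G.CartierFoata)

/-- The classes `m` such that in every factorization `m = m₁ m₂` every odd isotropic vertex has
initial multiplicity at most one in `m₂`, the initial multiplicity of `i` being the largest `k`
such that `m₂` is of the form `i^k u`. -/
def reducedClasses : Set G.CartierFoata :=
  {m | ∀ m₁ m₂, m = m₁ * m₂ → ∀ i ∈ G.isotropic, ∀ (k : ℕ) (u : G.CartierFoata),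
    m₂ = G.cls [i] ^ k * u → k ≤ 1}

theorem perm_of_cls_eq {v w : List I} (h : G.cls v = G.cls w) : v.Perm w := by
  rw [← Multiset.coe_eq_coe]
  have h' := (Con.eq _).1 h
  let f : FreeMonoid I →* Multiplicative (Multiset I) :=
    FreeMonoid.lift fun i => Multiplicative.ofAdd {i}
  have hf : ∀ w : List I, (f (FreeMonoid.ofList w)).toAdd = (w : Multiset I) := by
    intro w
    induction w with
    | nil => rfl
    | cons a w ih =>
      rw [FreeMonoid.ofList_cons, map_mul, toAdd_mul, ih]
      simp [f]
  have hle : conGen (fun u v : FreeMonoid I => ∃ a b, ¬ G.graph.Adj a b ∧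
      u = FreeMonoid.of a * FreeMonoid.of b ∧ v = FreeMonoid.of b * FreeMonoid.of a) ≤
      Con.ker f := by
    refine Con.conGen_le.2 ?_
    rintro _ _ ⟨a, b, -, rfl, rfl⟩
    rw [Con.ker_rel, map_mul, map_mul, mul_comm]
  have := hle h'
  rw [Con.ker_rel] at this
  rw [← hf, ← hf, this]

theorem exists_maxWord [LinearOrder I] (m : G.CartierFoata) :
    ∃ w : List I, G.cls w = m ∧ ∀ v : List I, G.cls v = m → v ≤ w := by
  obtain ⟨w₀, hw₀⟩ : ∃ w : List I, G.cls w = m := by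
    obtain ⟨x, rfl⟩ := Con.mk'_surjective m
    exact ⟨FreeMonoid.toList x, rfl⟩
  have hfin : {w : List I | G.cls w = m}.Finite := by
    refine (List.finite_toSet w₀.permutations).subset ?_
    intro v hv
    exact List.mem_permutations.2 (G.perm_of_cls_eq (hv.trans hw₀.symm))
  obtain ⟨w, hw, hmax⟩ := Set.exists_max_image _ id hfin ⟨w₀, hw₀⟩
  exact ⟨w, hw, hmax⟩

/-- The lexicographically largest word of a class. -/
def maxWord [LinearOrder I] (m : G.CartierFoata) : List I := (G.exists_maxWord m).choose

/-! ### The marked multivariate independence series -/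

/-- The marked multivariate independence series `∑ x^m`: the sum is over the finite
multi-subsets `m` of the vertices which have independent support and in which only isotropic
vertices may occur more than once. -/
def indepSeries : MvPowerSeries I ℂ := by
  classical
  exact fun m => if G.graph.IsIndepSet (m.support : Set I) ∧ ∀ i ∉ G.isotropic, m i ≤ 1
    then 1 else 0

theorem coeff_zero_indepSeries : MvPowerSeries.coeff 0 G.indepSeries = 1 := by
  simp [indepSeries, MvPowerSeries.coeff_apply]

end MarkedGraph

/-- `s` is the sum of the family `f` of formal power series: every monomial occurs in only
finitely many `f a`, and the coefficients of `s` are the sums of those of the `f a`. -/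
def HasFormalSum {I α : Type*} (f : α → MvPowerSeries I ℂ) (s : MvPowerSeries I ℂ) : Prop :=
  ∀ μ : I →₀ ℕ, {a | MvPowerSeries.coeff μ (f a) ≠ 0}.Finite ∧
    MvPowerSeries.coeff μ s = ∑ᶠ a, MvPowerSeries.coeff μ (f a)

/-! ### Right-angled Coxeter groups -/

namespace SimpleGraph

variable {I : Type*} (Γ : SimpleGraph I)

open Classical in
/-- The Coxeter matrix with `M i i = 1`, `M i j = 2` for distinct non-adjacent `i, j`, and
`M i j = ∞` (written `0`) for adjacent `i, j`. -/
def racgMatrix : CoxeterMatrix I where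
  M := Matrix.of fun i j => if i = j then 1 else if Γ.Adj i j then 0 else 2
  isSymm := by
    ext i j
    simp [Matrix.transpose_apply, eq_comm, Γ.adj_comm]
  diagonal := by simp
  off_diagonal := by
    intro i j h
    simp only [Matrix.of_apply, if_neg h]
    split_ifs <;> simp

/-- The right-angled Coxeter group: `s_i² = 1`, and `s_i s_j = s_j s_i` for non-adjacent
`i, j`. -/
abbrev Racg : Type _ := Γ.racgMatrix.Group

/-- The right-angled Coxeter group with its Coxeter generators. -/
abbrev racgSystem : CoxeterSystem Γ.racgMatrix Γ.Racg := Γ.racgMatrix.toCoxeterSystem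

/-- How often each letter occurs in a word. -/
def content (w : List I) : I →₀ ℕ := (w.map fun i => Finsupp.single i 1).sum

/-- The exponent of the monomial `x(w) = x_{i_1} ⋯ x_{i_k}`, for a reduced expression
`s_{i_1} ⋯ s_{i_k}` of `w`. -/
def racgWeight (w : Γ.Racg) : I →₀ ℕ :=
  content (Γ.racgSystem.exists_isReduced w).choose

/-- The monomial `x(w)`. -/
def racgMonomial (w : Γ.Racg) : MvPowerSeries I ℂ := MvPowerSeries.monomial (Γ.racgWeight w) 1

/-- The basis element `e(w)` of the group algebra. -/
def racgBasis (w : Γ.Racg) : MonoidAlgebra ℂ Γ.Racg := MonoidAlgebra.of ℂ Γ.Racg w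

/-- The graded piece of degree `μ` of the group algebra: the span of the `e(w)` with
`x(w) = x^μ`. -/
def racgPart (μ : I →₀ ℕ) : Submodule ℂ (MonoidAlgebra ℂ Γ.Racg) :=
  Submodule.span ℂ {a | ∃ w, Γ.racgWeight w = μ ∧ a = Γ.racgBasis w}

end SimpleGraph

end

/-! ### The Cartier-Foata monoid: universal property and content -/

noncomputable section

namespace MarkedGraph

variable {I : Type*} (G : MarkedGraph I)

/-! When every vertex is odd isotropic, $\mathbf U_{\mathcal G}$ is presented by the $e_i$ with
$e_ie_j=-e_je_i$ for non-adjacent $i,j$; the case $i=j$ says $e_i^2=0$. So a word in the $e_i$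
depends, up to sign, only on its class in the Cartier-Foata monoid, and it vanishes if the class has
a factor $ii$. Hence one word from each square-free class suffices to span (`span_maxProd`), and the
square-free classes are exactly $\mathcal M'(\mathcal G)$ (`mem_reducedClasses`).

Linear independence comes from a representation on the space with basis the classes: $e_i$ sends $m$
to $\pm im$ if $im$ is square-free and to $0$ otherwise, the sign counting the letters of $m$
smaller than $i$ (`eOp_mul_eOp_add`). Applied to the empty class, the word of a square-free class
gives a nonzero multiple of that class (`uRep_word`).

Square-free classes also index $W_{\mathcal G}$. The generator $s_i$ acts on them by toggling $i$:
an initial $i$ is removed, and otherwise $i$ is put in front. The orbit map at the empty class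
recovers a square-free $m$ from its image in the group, which gives injectivity; reduced words have
square-free classes, which gives surjectivity (`racgEquiv`). Contents match on both sides, hence the
graded isomorphism and the independence of $\mathbf x(w)$ from the reduced expression.

For the Hilbert series, the product of the series of square-free classes with $I(\mathcal G,-\mathbf
x)$ counts pairs $(U,m)$ of an independent multiset and a square-free class, with sign $(-1)^{|U|}$.
Moving one letter between $U$ and the front of $m$ is a sign-reversing involution on the pairs of a
given nonzero total content (`exists_toggle`, `squareFreeSeries_mul`). Grouping multisets by their
support gives the second formula. -/

theorem cls_nil : G.cls [] = 1 := rfl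

theorem cls_cons (a : I) (w : List I) : G.cls (a :: w) = G.cls [a] * G.cls w := rfl

theorem exists_cls_eq (m : G.CartierFoata) : ∃ w, G.cls w = m := by
  obtain ⟨x, rfl⟩ := Con.mk'_surjective m
  exact ⟨FreeMonoid.toList x, rfl⟩

theorem cls_comm {a b : I} (h : ¬ G.graph.Adj a b) :
    G.cls [a] * G.cls [b] = G.cls [b] * G.cls [a] :=
  (Con.eq _).2 (ConGen.Rel.of _ _ ⟨a, b, h, rfl, rfl⟩)

/-- The universal property of the Cartier-Foata monoid. -/
def liftCls {N : Type*} [Monoid N] (f : I → N)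
    (hf : ∀ a b, ¬ G.graph.Adj a b → f a * f b = f b * f a) : G.CartierFoata →* N :=
  Con.lift _ (FreeMonoid.lift f) (by
    refine Con.conGen_le.2 ?_
    rintro _ _ ⟨a, b, h, rfl, rfl⟩
    rw [Con.ker_rel]
    simpa using hf a b h)

theorem liftCls_cls {N : Type*} [Monoid N] (f : I → N)
    (hf : ∀ a b, ¬ G.graph.Adj a b → f a * f b = f b * f a) (w : List I) :
    G.liftCls f hf (G.cls w) = (w.map f).prod := by
  change FreeMonoid.lift f (FreeMonoid.ofList w) = _
  simp [FreeMonoid.lift_ofList]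

@[elab_as_elim]
theorem cls_induction {P : G.CartierFoata → Prop} (one : P 1)
    (cons : ∀ a m, P m → P (G.cls [a] * m)) (m : G.CartierFoata) : P m := by
  obtain ⟨w, rfl⟩ := G.exists_cls_eq m
  induction w with
  | nil => exact one
  | cons a w ih => exact cons a _ ih

/-- The content of a class. -/
def clsContent (m : G.CartierFoata) : I →₀ ℕ :=
  (G.liftCls (fun i => Multiplicative.ofAdd (Finsupp.single i 1)) (fun _ _ _ => mul_comm _ _)
    m).toAdd

theorem clsContent_mul (m n : G.CartierFoata) :
    G.clsContent (m * n) = G.clsContent m + G.clsContent n := by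
  simp [clsContent]

theorem clsContent_one : G.clsContent 1 = 0 := by
  simp [clsContent]

theorem clsContent_letter (i : I) : G.clsContent (G.cls [i]) = Finsupp.single i 1 := by
  simp [clsContent, liftCls_cls]

theorem clsContent_cls (w : List I) : G.clsContent (G.cls w) = SimpleGraph.content w := by
  induction w with
  | nil => simp [cls_nil, clsContent_one, SimpleGraph.content]
  | cons a w ih =>
    rw [cls_cons, clsContent_mul, ih, clsContent_letter]
    simp [SimpleGraph.content]

theorem toMultiset_content (w : List I) :
    Finsupp.toMultiset (SimpleGraph.content w) = (w : Multiset I) := by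
  induction w with
  | nil => simp [SimpleGraph.content]
  | cons a w ih =>
    have : SimpleGraph.content (a :: w) = Finsupp.single a 1 + SimpleGraph.content w := by
      simp [SimpleGraph.content]
    rw [this, map_add, ih]
    simp

theorem finite_clsContent_eq (μ : I →₀ ℕ) : {m | G.clsContent m = μ}.Finite := by
  refine ((List.finite_toSet (Finsupp.toMultiset μ).toList.permutations).image G.cls).subset ?_
  intro m hm
  obtain ⟨w, rfl⟩ := G.exists_cls_eq m
  refine ⟨w, List.mem_permutations.2 ?_, rfl⟩
  rw [← Multiset.coe_eq_coe, Multiset.coe_toList, ← toMultiset_content, ← clsContent_cls]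
  exact congrArg _ hm

/-! ### Stripping an initial letter -/

open Classical in
/-- One step of the recursion which strips an initial letter `i`. -/
def stripStep (i a : I) : Function.End (G.CartierFoata × Option G.CartierFoata) := fun x =>
  (G.cls [a] * x.1, if a = i then some x.1 else
    if G.graph.Adj a i then none else x.2.map (G.cls [a] * ·))

/-- This is what lets the recursion on words descend to classes. The state carries the current class
next to the stripped one because at a letter `a = i` the answer is the class read so far. -/
theorem stripStep_comm (i : I) {a b : I} (h : ¬ G.graph.Adj a b) :
    G.stripStep i a * G.stripStep i b = G.stripStep i b * G.stripStep i a := by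
  funext ⟨m, d⟩
  have h' : ¬ G.graph.Adj b a := fun hh => h hh.symm
  change G.stripStep i a (G.stripStep i b (m, d)) = G.stripStep i b (G.stripStep i a (m, d))
  simp only [stripStep, ← mul_assoc, G.cls_comm h, Prod.mk.injEq, true_and]
  by_cases ha : a = i
  · subst ha
    by_cases hb : b = a
    · simp [hb]
    · simp [hb, h']
  · by_cases hb : b = i
    · subst hb
      simp [ha, h]
    · simp only [ha, hb, if_false]
      split_ifs
      · rfl
      · rfl
      · rfl
      · simp [Option.map_map, Function.comp_def, ← mul_assoc, G.cls_comm h]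

/-- `strip i m = some t` if and only if `m = i t`. -/
def strip (i : I) (m : G.CartierFoata) : Option G.CartierFoata :=
  (G.liftCls (G.stripStep i) (fun _ _ h => G.stripStep_comm i h) m (1, none)).2

theorem strip_aux (i : I) (m : G.CartierFoata) :
    G.liftCls (G.stripStep i) (fun _ _ h => G.stripStep_comm i h) m (1, none) =
      (m, G.strip i m) := by
  refine Prod.ext ?_ rfl
  induction m using cls_induction with
  | one => rw [map_one]; rfl
  | cons a m ih =>
    rw [map_mul, liftCls_cls, List.map_singleton, List.prod_singleton]
    change (G.stripStep i a _).1 = _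
    simp [stripStep, ih]

open Classical in
theorem strip_letter_mul (i a : I) (m : G.CartierFoata) :
    G.strip i (G.cls [a] * m) = if a = i then some m else
      if G.graph.Adj a i then none else (G.strip i m).map (G.cls [a] * ·) := by
  conv_lhs => rw [strip, map_mul, liftCls_cls, List.map_singleton, List.prod_singleton]
  change (G.stripStep i a _).2 = _
  rw [strip_aux, stripStep]

theorem strip_one (i : I) : G.strip i 1 = none := by
  rw [strip, map_one]; rfl

theorem strip_self (i : I) (m : G.CartierFoata) : G.strip i (G.cls [i] * m) = some m := by
  simp [strip_letter_mul]

theorem strip_of_not_adj {i a : I} (hne : a ≠ i) (h : ¬ G.graph.Adj a i) (m : G.CartierFoata) :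
    G.strip i (G.cls [a] * m) = (G.strip i m).map (G.cls [a] * ·) := by
  simp [strip_letter_mul, hne, h]

/-- An occurrence of `i` is found behind letters that are not adjacent to it, and each of these can
be commuted past it. -/
theorem strip_eq_some_iff {i : I} {m t : G.CartierFoata} :
    G.strip i m = some t ↔ m = G.cls [i] * t := by
  refine ⟨?_, fun h => h ▸ G.strip_self i t⟩
  induction m using cls_induction generalizing t with
  | one => simp [strip_one]
  | cons a m ih =>
    rw [strip_letter_mul]
    split_ifs with h1 h2
    · rintro ⟨⟩; rw [h1]
    · simp
    · rw [Option.map_eq_some_iff]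
      rintro ⟨s, hs, rfl⟩
      rw [ih hs, ← mul_assoc, ← mul_assoc, G.cls_comm h2]

theorem strip_eq_none_iff {i : I} {m : G.CartierFoata} :
    G.strip i m = none ↔ ∀ t, m ≠ G.cls [i] * t := by
  rw [Option.eq_none_iff_forall_ne_some]
  exact forall_congr' fun t => not_congr G.strip_eq_some_iff

/-- Cancellation holds because `strip i` is a left inverse of multiplication by the letter. -/
theorem letter_mul_cancel {i : I} {m t : G.CartierFoata} (h : G.cls [i] * m = G.cls [i] * t) :
    m = t := by
  have := G.strip_self i m
  rw [h, strip_self] at this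
  exact (Option.some.inj this).symm

/-- Two distinct initial letters of a class commute. -/
theorem letter_mul_eq_letter_mul {i j : I} (hne : i ≠ j) {m n : G.CartierFoata}
    (h : G.cls [i] * m = G.cls [j] * n) :
    ¬ G.graph.Adj i j ∧ ∃ t, m = G.cls [j] * t ∧ n = G.cls [i] * t := by
  have h1 := G.strip_eq_some_iff.2 h.symm
  rw [strip_letter_mul, if_neg hne.symm] at h1
  split_ifs at h1 with h2
  obtain ⟨t, ht, rfl⟩ := Option.map_eq_some_iff.1 h1
  exact ⟨fun h => h2 h.symm, t, rfl, G.strip_eq_some_iff.1 ht⟩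

/-! ### Square-free classes -/

/-- A class is square-free if it has no factor `i i`. -/
def SquareFree (m : G.CartierFoata) : Prop :=
  ∀ m₁ i m₂, m ≠ m₁ * (G.cls [i] * (G.cls [i] * m₂))

theorem mem_reducedClasses (hG : G.isotropic = Set.univ) {m : G.CartierFoata} :
    m ∈ G.reducedClasses ↔ G.SquareFree m := by
  constructor
  · rintro h m₁ i m₂ rfl
    have := h m₁ _ rfl i (by simp [hG]) 2 m₂ (by rw [pow_two, mul_assoc])
    omega
  · rintro h m₁ m₂ rfl i - k u rfl
    by_contra! hk
    obtain ⟨k, rfl⟩ := Nat.exists_eq_add_of_le hk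
    refine h m₁ i (G.cls [i] ^ k * u) ?_
    rw [pow_add, Nat.succ_eq_add_one, one_add_one_eq_two, pow_two]
    simp only [mul_assoc]

variable {G}

theorem SquareFree.right {m n : G.CartierFoata} (h : G.SquareFree (m * n)) : G.SquareFree n := by
  rintro m₁ i m₂ rfl
  exact h (m * m₁) i m₂ (by rw [mul_assoc])

theorem squareFree_one : G.SquareFree 1 := by
  intro m₁ i m₂ h
  have := congrArg G.clsContent h
  simp only [clsContent_mul, clsContent_letter, clsContent_one] at this
  have := DFunLike.congr_fun this i
  simp at this
  omega

theorem SquareFree.strip_eq_none {i : I} {m : G.CartierFoata}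
    (h : G.SquareFree (G.cls [i] * m)) : G.strip i m = none := by
  rw [strip_eq_none_iff]
  rintro t rfl
  exact h 1 i t (by rw [one_mul])

/-- A square can be created only by the new letter. By induction on the prefix `m₁` of the supposed
square: if `m₁` starts with `i`, cancel it and find the square in `m`; if it starts with another
letter `a`, then `a` and `i` commute, `a` can be split off from `m`, and the remainder is shorter
and still has no initial `i`. For an empty prefix the square itself is at the front. -/
theorem SquareFree.letter_mul {i : I} {m : G.CartierFoata} (h : G.SquareFree m)
    (hi : G.strip i m = none) : G.SquareFree (G.cls [i] * m) := by
  intro m₁ j u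
  induction m₁ using cls_induction generalizing m with
  | one =>
    rw [one_mul]
    intro heq
    rw [strip_eq_none_iff] at hi
    by_cases hij : i = j
    · subst hij
      exact hi u (G.letter_mul_cancel heq)
    · obtain ⟨-, t, rfl, ht⟩ := G.letter_mul_eq_letter_mul hij heq
      obtain ⟨-, s, rfl, rfl⟩ := G.letter_mul_eq_letter_mul (Ne.symm hij) ht
      exact h 1 j s (by rw [one_mul])
  | cons a m₁ ih =>
    intro heq
    rw [mul_assoc] at heq
    by_cases hia : i = a
    · subst hia
      exact h _ _ _ (G.letter_mul_cancel heq)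
    · obtain ⟨hadj, t, rfl, ht⟩ := G.letter_mul_eq_letter_mul hia heq
      refine ih h.right ?_ ht.symm
      rw [G.strip_of_not_adj (Ne.symm hia) (fun h => hadj h.symm)] at hi
      simpa using hi

/-! ### The action of the right-angled Coxeter group -/

variable (G) in
/-- Strip the initial letter `i` if there is one, and add it otherwise. -/
def toggle (i : I) (m : G.CartierFoata) : G.CartierFoata :=
  (G.strip i m).getD (G.cls [i] * m)

theorem toggle_of_some {i : I} {m t : G.CartierFoata} (h : G.strip i m = some t) :
    G.toggle i m = t := by simp [toggle, h]

theorem toggle_of_none {i : I} {m : G.CartierFoata} (h : G.strip i m = none) :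
    G.toggle i m = G.cls [i] * m := by simp [toggle, h]

theorem SquareFree.toggle {i : I} {m : G.CartierFoata} (h : G.SquareFree m) :
    G.SquareFree (G.toggle i m) := by
  rcases hs : G.strip i m with _ | t
  · rw [toggle_of_none hs]; exact h.letter_mul hs
  · rw [toggle_of_some hs]
    rw [G.strip_eq_some_iff.1 hs] at h
    exact h.right

theorem SquareFree.toggle_toggle {i : I} {m : G.CartierFoata} (h : G.SquareFree m) :
    G.toggle i (G.toggle i m) = m := by
  rcases hs : G.strip i m with _ | t
  · rw [toggle_of_none hs, toggle_of_some (G.strip_self i m)]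
  · rw [toggle_of_some hs]
    rw [G.strip_eq_some_iff] at hs
    subst hs
    rw [toggle_of_none h.strip_eq_none]

/-- Toggling one of two distinct commuting letters does not change whether the other is initial. -/
theorem toggle_comm {i j : I} (hne : i ≠ j) (hadj : ¬ G.graph.Adj i j) (m : G.CartierFoata) :
    G.toggle i (G.toggle j m) = G.toggle j (G.toggle i m) := by
  have hadj' : ¬ G.graph.Adj j i := fun h => hadj h.symm
  have hi := G.strip_of_not_adj hne hadj
  have hj := G.strip_of_not_adj hne.symm hadj'
  rcases hs : G.strip i m with _ | t
  · rcases hs' : G.strip j m with _ | t'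
    · rw [toggle_of_none hs, toggle_of_none hs', toggle_of_none (by rw [hj, hs]; rfl),
        toggle_of_none (by rw [hi, hs']; rfl), ← mul_assoc, ← mul_assoc, G.cls_comm hadj]
    · have h1 : G.strip j (G.cls [i] * m) = some (G.cls [i] * t') := by rw [hi, hs']; rfl
      have h2 : G.strip i t' = none := by
        rw [G.strip_eq_some_iff.1 hs', hj] at hs
        simpa using hs
      rw [toggle_of_none hs, toggle_of_some hs', toggle_of_some h1, toggle_of_none h2]
  · rw [toggle_of_some hs]
    rw [G.strip_eq_some_iff] at hs
    subst hs
    rcases hs' : G.strip j t with _ | t'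
    · have h1 : G.strip j (G.cls [i] * t) = none := by rw [hi, hs']; rfl
      have h2 : G.strip i (G.cls [j] * (G.cls [i] * t)) = some (G.cls [j] * t) := by
        rw [hj, strip_self]; rfl
      rw [toggle_of_none hs', toggle_of_none h1, toggle_of_some h2]
    · have h1 : G.strip j (G.cls [i] * t) = some (G.cls [i] * t') := by rw [hi, hs']; rfl
      rw [toggle_of_some hs', toggle_of_some h1, toggle_of_some (G.strip_self i t')]

open Classical in
variable (G) in
theorem racgMatrix_apply (i j : I) : G.graph.racgMatrix i j =
    if i = j then 1 else if G.graph.Adj i j then 0 else 2 := rfl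

variable (G) in
/-- The involution of the square-free classes given by toggling `i`. -/
def togglePerm (i : I) : Equiv.Perm {m // G.SquareFree m} where
  toFun m := ⟨G.toggle i m.1, m.2.toggle⟩
  invFun m := ⟨G.toggle i m.1, m.2.toggle⟩
  left_inv m := Subtype.ext m.2.toggle_toggle
  right_inv m := Subtype.ext m.2.toggle_toggle

theorem isLiftable_togglePerm : G.graph.racgMatrix.IsLiftable G.togglePerm := by
  intro i j
  rw [racgMatrix_apply]
  -- The three entries of the Coxeter matrix: `1` asks that toggling be an involution, `0` (that is,
  -- ∞) asks nothing, and `2` asks that the toggles commute.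
  split_ifs with h1 h2
  · subst h1
    rw [pow_one]
    ext m
    exact congrArg Subtype.val ((G.togglePerm i).left_inv m)
  · rw [pow_zero]
  · rw [pow_two]
    ext m
    change G.toggle i (G.toggle j (G.toggle i (G.toggle j m.1))) = m.1
    rw [toggle_comm h1 h2 m.1, (m.2.toggle.toggle_toggle (i := j)), m.2.toggle_toggle]

variable (G) in
/-- The action of the right-angled Coxeter group on the square-free classes. -/
def racgAction : G.graph.Racg →* Equiv.Perm {m // G.SquareFree m} :=
  G.graph.racgSystem.lift ⟨G.togglePerm, isLiftable_togglePerm⟩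

/-- Reading a square-free word from the right, no letter is initial in what has already been built,
so every toggle adds its letter. -/
theorem racgAction_wordProd (w : List I) (h : G.SquareFree (G.cls w)) :
    (G.racgAction (G.graph.racgSystem.wordProd w) ⟨1, squareFree_one⟩).1 = G.cls w := by
  induction w with
  | nil => simp [CoxeterSystem.wordProd_nil, cls_nil]
  | cons a w ih =>
    rw [cls_cons] at h ⊢
    rw [CoxeterSystem.wordProd_cons, map_mul, Equiv.Perm.mul_apply, racgAction,
      CoxeterSystem.lift_apply_simple]
    change G.toggle a (G.racgAction _ _).1 = _
    rw [ih h.right, toggle_of_none h.strip_eq_none]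

variable (G) in
/-- The canonical map of the Cartier-Foata monoid to the right-angled Coxeter group. -/
def toRacg : G.CartierFoata →* G.graph.Racg :=
  G.liftCls G.graph.racgSystem.simple (by
    intro a b h
    by_cases hab : a = b
    · rw [hab]
    have hM : G.graph.racgMatrix a b = 2 := by
      rw [racgMatrix_apply, if_neg hab, if_neg h]
    have h2 := G.graph.racgSystem.simple_mul_simple_pow a b
    rw [hM, pow_two] at h2
    have h3 := eq_inv_of_mul_eq_one_left h2
    rwa [mul_inv_rev, CoxeterSystem.inv_simple, CoxeterSystem.inv_simple] at h3)

theorem toRacg_cls (w : List I) : G.toRacg (G.cls w) = G.graph.racgSystem.wordProd w := by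
  rw [toRacg, liftCls_cls]; rfl

theorem racgAction_toRacg {m : G.CartierFoata} (h : G.SquareFree m) :
    (G.racgAction (G.toRacg m) ⟨1, squareFree_one⟩).1 = m := by
  obtain ⟨w, rfl⟩ := G.exists_cls_eq m
  rw [toRacg_cls, racgAction_wordProd w h]

/-- A factor `i i` cancels in the group, leaving an expression of the same element that is shorter
by two letters. -/
theorem squareFree_of_isReduced {w : List I} (h : G.graph.racgSystem.IsReduced w) :
    G.SquareFree (G.cls w) := by
  intro m₁ i m₂ heq
  obtain ⟨v₁, rfl⟩ := G.exists_cls_eq m₁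
  obtain ⟨v₂, rfl⟩ := G.exists_cls_eq m₂
  have hl := (G.perm_of_cls_eq (v := w) (w := v₁ ++ (i :: i :: v₂)) heq).length_eq
  have hp : G.graph.racgSystem.wordProd w = G.graph.racgSystem.wordProd (v₁ ++ v₂) := by
    rw [← toRacg_cls, heq, map_mul, map_mul, map_mul, CoxeterSystem.wordProd_append,
      toRacg_cls, toRacg_cls, toRacg_cls, CoxeterSystem.wordProd_singleton,
      CoxeterSystem.simple_mul_simple_cancel_left]
  have hlen := G.graph.racgSystem.length_wordProd_le (v₁ ++ v₂)
  rw [← hp, h] at hlen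
  simp at hl hlen
  omega

variable (G) in
/-- Square-free classes correspond to the elements of the right-angled Coxeter group. -/
def racgEquiv : {m // G.SquareFree m} ≃ G.graph.Racg :=
  Equiv.ofBijective (fun m => G.toRacg m.1) (by
    constructor
    · intro m n h
      apply Subtype.ext
      rw [← racgAction_toRacg m.2, ← racgAction_toRacg n.2]
      exact congrArg (fun w => (G.racgAction w ⟨1, squareFree_one⟩).1) h
    · intro w
      obtain ⟨v, hv, rfl⟩ := G.graph.racgSystem.exists_isReduced w
      exact ⟨⟨G.cls v, squareFree_of_isReduced hv⟩, toRacg_cls v⟩)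

theorem racgEquiv_apply (m : {m // G.SquareFree m}) : G.racgEquiv m = G.toRacg m.1 := rfl

/-- The reduced word chosen in `racgWeight` has a square-free class with the same image as `m`, so
injectivity of `racgEquiv` makes it a word of `m`. -/
theorem racgWeight_toRacg {m : G.CartierFoata} (h : G.SquareFree m) :
    G.graph.racgWeight (G.toRacg m) = G.clsContent m := by
  have hs := (G.graph.racgSystem.exists_isReduced (G.toRacg m)).choose_spec
  set v := (G.graph.racgSystem.exists_isReduced (G.toRacg m)).choose with hv
  have : (⟨m, h⟩ : {m // G.SquareFree m}) = ⟨G.cls v, squareFree_of_isReduced hs.1⟩ :=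
    G.racgEquiv.injective (by
      rw [racgEquiv_apply, racgEquiv_apply, toRacg_cls]
      exact hs.2)
  rw [Subtype.mk.injEq] at this
  rw [SimpleGraph.racgWeight, ← hv, ← clsContent_cls, ← this]

end MarkedGraph

end

/-! ### Graded subspaces and the universal property of the enveloping algebra -/

noncomputable section

namespace LieSuperalgebra

variable {L : Type*} [AddCommGroup L] [Module ℂ L] (g : LieSuperalgebra L)

/-- The largest graded subspace of a subspace. -/
def homPart (K : Submodule ℂ L) : Submodule ℂ L := (g.part 0 ⊓ K) ⊔ (g.part 1 ⊓ K)

theorem homPart_le (K : Submodule ℂ L) : g.homPart K ≤ K := sup_le inf_le_right inf_le_right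

variable {g}

theorem mem_homPart {K : Submodule ℂ L} {p : ZMod 2} {x : L} (hx : x ∈ g.part p) (hK : x ∈ K) :
    x ∈ g.homPart K := by
  fin_cases p
  · exact Submodule.mem_sup_left ⟨hx, hK⟩
  · exact Submodule.mem_sup_right ⟨hx, hK⟩

theorem isGraded_homPart (K : Submodule ℂ L) : g.IsGraded (g.homPart K) := by
  intro x hx y hy h
  obtain ⟨a, ha, b, hb, hab⟩ := Submodule.mem_sup.1 h
  have h0 : x - a = 0 := by
    refine Submodule.disjoint_def.1 g.isCompl.disjoint _ (sub_mem hx ha.1) ?_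
    have : x - a = b - y := by
      rw [sub_eq_sub_iff_add_eq_add, ← hab, add_comm]
    rw [this]
    exact sub_mem hb.1 hy
  have hxa : x = a := sub_eq_zero.1 h0
  subst hxa
  have hyb : b = y := add_left_cancel hab
  subst hyb
  exact ⟨mem_homPart hx ha.2, mem_homPart hy hb.2⟩

/-- An induction principle that needs neither gradedness of `K` nor closure beyond homogeneous
elements: `homPart` is graded and inherits the closure. This matters because the supercommutator has
a usable formula only on homogeneous elements. -/
theorem subSpan_le {K : Submodule ℂ L} {S : Set L} (hS : ∀ x ∈ S, x ∈ K ∧ ∃ p, x ∈ g.part p)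
    (hK : ∀ p q x y, x ∈ g.part p → x ∈ K → y ∈ g.part q → y ∈ K → g.bracket x y ∈ K) :
    g.subSpan S ≤ K := by
  have hsub : g.IsSub (g.homPart K) → (S : Set L) ⊆ g.homPart K → g.subSpan S ≤ K :=
    fun h h' => (sInf_le (a := g.homPart K) (And.intro h' h)).trans (g.homPart_le K)
  refine hsub ⟨isGraded_homPart K, ?_⟩ ?_
  rotate_left
  · intro x hx
    obtain ⟨h1, p, h2⟩ := hS x hx
    exact mem_homPart h2 h1
  · intro x hx y hy
    obtain ⟨a, ha, b, hb, rfl⟩ := Submodule.mem_sup.1 hx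
    obtain ⟨c, hc, d, hd, rfl⟩ := Submodule.mem_sup.1 hy
    have key : ∀ p q x y, x ∈ g.part p ⊓ K → y ∈ g.part q ⊓ K → g.bracket x y ∈ g.homPart K :=
      fun p q x y hx hy => mem_homPart (g.bracket_mem hx.1 hy.1) (hK p q x y hx.1 hx.2 hy.1 hy.2)
    simp only [map_add, LinearMap.add_apply]
    exact add_mem (add_mem (key _ _ _ _ ha hc) (key _ _ _ _ hb hc))
      (add_mem (key _ _ _ _ ha hd) (key _ _ _ _ hb hd))

/-- As for `subSpan_le`; super skew-symmetry reduces brackets on the right to brackets on the left.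
-/
theorem idealSpan_le {K : Submodule ℂ L} {S : Set L} (hS : ∀ x ∈ S, x ∈ K ∧ ∃ p, x ∈ g.part p)
    (hK : ∀ p q x y, x ∈ g.part p → y ∈ g.part q → y ∈ K → g.bracket x y ∈ K) :
    g.idealSpan S ≤ K := by
  have key : ∀ p q x y, x ∈ g.part p → y ∈ g.part q ⊓ K → g.bracket x y ∈ g.homPart K :=
    fun p q x y hx hy => mem_homPart (g.bracket_mem hx hy.1) (hK p q x y hx hy.1 hy.2)
  have key' : ∀ p q x y, x ∈ g.part p → y ∈ g.part q ⊓ K → g.bracket y x ∈ g.homPart K := by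
    intro p q x y hx hy
    rw [g.skew hy.1 hx]
    exact neg_mem (Submodule.smul_mem _ _ (key p q x y hx hy))
  have hideal : g.IsIdeal (g.homPart K) → (S : Set L) ⊆ g.homPart K → g.idealSpan S ≤ K :=
    fun h h' => (sInf_le (a := g.homPart K) (And.intro h' h)).trans (g.homPart_le K)
  refine hideal ⟨isGraded_homPart K, ?_, ?_⟩ ?_
  rotate_right
  · intro x hx
    obtain ⟨h1, p, h2⟩ := hS x hx
    exact mem_homPart h2 h1
  · intro x y hy
    obtain ⟨a, ha, b, hb, rfl⟩ := g.exists_add x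
    obtain ⟨c, hc, d, hd, rfl⟩ := Submodule.mem_sup.1 hy
    simp only [map_add, LinearMap.add_apply]
    exact add_mem (add_mem (key _ _ _ _ ha hc) (key _ _ _ _ hb hc))
      (add_mem (key _ _ _ _ ha hd) (key _ _ _ _ hb hd))
  · intro y hy x
    obtain ⟨a, ha, b, hb, rfl⟩ := g.exists_add x
    obtain ⟨c, hc, d, hd, rfl⟩ := Submodule.mem_sup.1 hy
    simp only [map_add, LinearMap.add_apply]
    exact add_mem (add_mem (key' _ _ _ _ ha hc) (key' _ _ _ _ ha hd))
      (add_mem (key' _ _ _ _ hb hc) (key' _ _ _ _ hb hd))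

theorem envι_bracket {p q : ZMod 2} {x y : L} (hx : x ∈ g.part p) (hy : y ∈ g.part q) :
    g.envι (g.bracket x y) = g.envι x * g.envι y - superSign p q • (g.envι y * g.envι x) := by
  have := RingQuot.mkAlgHom_rel ℂ (EnvRel.bracket hx hy)
  simpa [envι] using this

/-- The universal property of the universal enveloping algebra. -/
def envLift {A : Type*} [Ring A] [Algebra ℂ A] (f : L →ₗ[ℂ] A)
    (hf : ∀ p q x y, x ∈ g.part p → y ∈ g.part q →
      f (g.bracket x y) = f x * f y - superSign p q • (f y * f x)) : g.Env →ₐ[ℂ] A :=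
  RingQuot.liftAlgHom ℂ ⟨TensorAlgebra.lift ℂ f, by
    rintro _ _ ⟨hx, hy⟩
    simpa using hf _ _ _ _ hx hy⟩

theorem envLift_envι {A : Type*} [Ring A] [Algebra ℂ A] (f : L →ₗ[ℂ] A)
    (hf : ∀ p q x y, x ∈ g.part p → y ∈ g.part q →
      f (g.bracket x y) = f x * f y - superSign p q • (f y * f x)) (x : L) :
    g.envLift f hf (g.envι x) = f x := by
  simp [envLift, envι]

end LieSuperalgebra

theorem freeAlgebraPart_zero_eq_top {I : Type*} :
    freeAlgebraPart (fun _ : I => (0 : ℕ)) 0 = ⊤ := by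
  rw [eq_top_iff]
  rintro x -
  induction x with
  | grade0 r =>
    rw [Algebra.algebraMap_eq_smul_one]
    exact Submodule.smul_mem _ _ (SetLike.GradedOne.one_mem)
  | grade1 i => exact ι_mem_freeAlgebraPart _ i
  | mul a b ha hb => exact SetLike.GradedMul.mul_mem (i := 0) (j := 0) ha hb
  | add a b ha hb => exact add_mem ha hb

/-! ### The enveloping algebra as a quotient of the free associative algebra -/

namespace MarkedGraph

variable {I : Type*} (G : MarkedGraph I)

theorem freeAssoc_bracket {p q : ZMod 2} {x y : FreeAlgebra ℂ I} (hx : x ∈ G.freeAssoc.part p)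
    (hy : y ∈ G.freeAssoc.part q) :
    G.freeAssoc.bracket x y = x * y - superSign p q • (y * x) :=
  superCommutator_apply _ hx hy

theorem ι_mem_part (i : I) : FreeAlgebra.ι ℂ i ∈ G.freeAssoc.part (G.parity i) :=
  ι_mem_freeAlgebraPart _ i

/-- The homomorphism of the free associative algebra onto the enveloping algebra. -/
def toU : FreeAlgebra ℂ I →ₐ[ℂ] G.U := FreeAlgebra.lift ℂ G.e

theorem toU_word (w : List I) :
    G.toU (w.map (FreeAlgebra.ι ℂ)).prod = (w.map G.e).prod := by
  rw [map_list_prod, List.map_map]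
  congr 2
  funext i
  simp [toU]

theorem pclsa_bracket_mkQ (x y : G.freeLieCarrier) :
    G.pclsa.bracket (G.pclsaIdeal.mkQ x) (G.pclsaIdeal.mkQ y) =
      G.pclsaIdeal.mkQ (G.freeLie.bracket x y) := rfl

theorem coe_freeLie_bracket (x y : G.freeLieCarrier) :
    (G.freeLie.bracket x y).1 = G.freeAssoc.bracket x.1 y.1 := rfl

theorem mkQ_mem_part {p : ZMod 2} {x : G.freeLieCarrier} (hx : x.1 ∈ G.freeAssoc.part p) :
    G.pclsaIdeal.mkQ x ∈ G.pclsa.part p := ⟨x, hx, rfl⟩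

theorem exists_mkQ_of_mem_part {p : ZMod 2} {x : G.Pclsa} (hx : x ∈ G.pclsa.part p) :
    ∃ y : G.freeLieCarrier, y.1 ∈ G.freeAssoc.part p ∧ G.pclsaIdeal.mkQ y = x := hx

/-- Both sides agree on the generators and turn brackets of homogeneous elements into
supercommutators, so they agree on the Lie sub-superalgebra that the generators generate.
Consequently the `e i` generate the enveloping algebra. -/
theorem envι_mkQ (x : G.freeLieCarrier) : G.pclsa.envι (G.pclsaIdeal.mkQ x) = G.toU x.1 := by
  have key : G.freeLieCarrier ≤ (LinearMap.ker
      (G.pclsa.envι ∘ₗ G.pclsaIdeal.mkQ - G.toU.toLinearMap ∘ₗ G.freeLieCarrier.subtype)).map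
      G.freeLieCarrier.subtype := by
    refine LieSuperalgebra.subSpan_le ?_ ?_
    · rintro _ ⟨i, rfl⟩
      refine ⟨⟨G.freeGen i, ?_, rfl⟩, _, G.ι_mem_part i⟩
      simp [toU, e, freeGen]
    · rintro p q _ _ hx ⟨x, hx', rfl⟩ hy ⟨y, hy', rfl⟩
      refine ⟨G.freeLie.bracket x y, ?_, rfl⟩
      have hx1 : G.pclsa.envι (G.pclsaIdeal.mkQ x) = G.toU x.1 := by
        simpa [sub_eq_zero] using hx'
      have hy1 : G.pclsa.envι (G.pclsaIdeal.mkQ y) = G.toU y.1 := by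
        simpa [sub_eq_zero] using hy'
      have h2 : G.pclsa.envι (G.pclsaIdeal.mkQ (G.freeLie.bracket x y)) =
          G.toU (G.freeLie.bracket x y).1 := by
        rw [← pclsa_bracket_mkQ, LieSuperalgebra.envι_bracket (G.mkQ_mem_part hx)
          (G.mkQ_mem_part hy), coe_freeLie_bracket, G.freeAssoc_bracket (x := x.1) (y := y.1) hx hy,
          hx1, hy1, map_sub, map_smul, map_mul, map_mul]
      exact LinearMap.mem_ker.2 (sub_eq_zero.2 h2)
  obtain ⟨y, hy, hyx⟩ := key x.2
  obtain rfl : y = x := Subtype.ext hyx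
  simpa [sub_eq_zero] using hy

theorem toU_surjective : Function.Surjective G.toU := by
  intro u
  obtain ⟨t, rfl⟩ := RingQuot.mkAlgHom_surjective ℂ G.pclsa.EnvRel u
  rw [← AlgHom.mem_range]
  induction t using TensorAlgebra.induction with
  | algebraMap r => rw [AlgHom.commutes]; exact Subalgebra.algebraMap_mem _ r
  | ι x =>
    obtain ⟨x, rfl⟩ := G.pclsaIdeal.mkQ_surjective x
    exact ⟨x.1, (G.envι_mkQ x).symm⟩
  | mul a b ha hb => rw [map_mul]; exact mul_mem ha hb
  | add a b ha hb => rw [map_add]; exact add_mem ha hb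

theorem span_words : Submodule.span ℂ (Set.range fun w : List I => (w.map G.e).prod) = ⊤ := by
  rw [eq_top_iff]
  rintro u -
  obtain ⟨x, rfl⟩ := G.toU_surjective u
  -- With all weights zero, this graded piece is the span of all words, so span induction becomes
  -- induction over words.
  have hx : x ∈ freeAlgebraPart (fun _ : I => (0 : ℕ)) 0 := by
    rw [freeAlgebraPart_zero_eq_top]; trivial
  induction hx using Submodule.span_induction with
  | mem x h =>
    obtain ⟨w, -, rfl⟩ := h
    rw [toU_word]
    exact Submodule.subset_span ⟨w, rfl⟩
  | zero => rw [map_zero]; exact zero_mem _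
  | add x y _ _ h1 h2 => rw [map_add]; exact add_mem h1 h2
  | smul c x _ h => rw [map_smul]; exact Submodule.smul_mem _ c h

/-- A homogeneous element of the Lie superalgebra lifts to a homogeneous element of the free algebra
of the same degree, and such an element is a combination of words of that content. -/
theorem uPart_eq (μ : I →₀ ℕ) : G.uPart μ =
    Submodule.span ℂ {a | ∃ w : List I, SimpleGraph.content w = μ ∧ a = (w.map G.e).prod} := by
  apply le_antisymm
  · refine Submodule.span_le.2 ?_
    rintro _ ⟨l, hl, rfl, rfl⟩
    have hex : ∃ x ∈ freeAlgebraPart (fun i : I => Finsupp.single i 1) (l.map Prod.fst).sum,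
        G.toU x = (l.map fun t => G.pclsa.envι t.2).prod := by
      induction l with
      | nil => exact ⟨1, SetLike.GradedOne.one_mem, by simp⟩
      | cons t l ih =>
        obtain ⟨x, hx, hx'⟩ := ih fun t ht => hl t (List.mem_cons_of_mem _ ht)
        obtain ⟨y, hy, hy'⟩ := hl t List.mem_cons_self
        refine ⟨y.1 * x, SetLike.GradedMul.mul_mem hy hx, ?_⟩
        rw [map_mul, hx', ← envι_mkQ, hy', List.map_cons, List.prod_cons]
    obtain ⟨x, hx, hx'⟩ := hex
    rw [← hx']
    clear hx' hl
    induction hx using Submodule.span_induction with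
    | mem x h =>
      obtain ⟨w, hw, rfl⟩ := h
      rw [toU_word]
      exact Submodule.subset_span ⟨w, hw, rfl⟩
    | zero => rw [map_zero]; exact zero_mem _
    | add x y _ _ h1 h2 => rw [map_add]; exact add_mem h1 h2
    | smul c x _ h => rw [map_smul]; exact Submodule.smul_mem _ c h
  · refine Submodule.span_le.2 ?_
    rintro _ ⟨w, rfl, rfl⟩
    refine Submodule.subset_span
      ⟨w.map fun i => (Finsupp.single i 1, G.pclsaIdeal.mkQ (G.freeGen i)), ?_, ?_, ?_⟩
    · simp only [List.mem_map]
      rintro _ ⟨i, -, rfl⟩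
      exact ⟨G.freeGen i, ι_mem_freeAlgebraPart (fun i : I => Finsupp.single i 1) i, rfl⟩
    · simp [SimpleGraph.content, Function.comp_def]
    · rw [List.map_map]; rfl

/-! ### The relations between the generators -/

variable {G}

theorem parity_eq_one (hG : G.isotropic = Set.univ) (i : I) : G.parity i = 1 := by
  have : i ∈ G.odd := G.isotropic_subset (hG ▸ Set.mem_univ i)
  simp [parity, this]

theorem superSign_one_one : superSign 1 1 = -1 := by
  simp [superSign, ZMod.val_one]

theorem ι_mem_part_one (hG : G.isotropic = Set.univ) (i : I) :
    FreeAlgebra.ι ℂ i ∈ G.freeAssoc.part 1 := by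
  rw [← parity_eq_one hG i]; exact G.ι_mem_part i

theorem freeLie_bracket_gen (hG : G.isotropic = Set.univ) (i j : I) :
    (G.freeLie.bracket (G.freeGen i) (G.freeGen j)).1 =
      FreeAlgebra.ι ℂ i * FreeAlgebra.ι ℂ j + FreeAlgebra.ι ℂ j * FreeAlgebra.ι ℂ i := by
  have := G.freeAssoc_bracket (ι_mem_part_one hG i) (ι_mem_part_one hG j)
  rw [superSign_one_one, neg_one_smul, sub_neg_eq_add] at this
  exact this

theorem e_mul_e_add (hG : G.isotropic = Set.univ) {i j : I} (h : ¬ G.graph.Adj i j) :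
    G.e i * G.e j + G.e j * G.e i = 0 := by
  have h1 : G.pclsaIdeal.mkQ (G.freeLie.bracket (G.freeGen i) (G.freeGen j)) = 0 := by
    rw [Submodule.mkQ_apply, Submodule.Quotient.mk_eq_zero, pclsaIdeal,
      LieSuperalgebra.idealSpan, Submodule.mem_sInf]
    rintro N ⟨hN, -⟩
    by_cases hij : i = j
    · subst hij
      exact hN (Or.inr ⟨i, by simp [hG], rfl⟩)
    · exact hN (Or.inl ⟨i, j, hij, h, rfl⟩)
  have h2 := G.envι_mkQ (G.freeLie.bracket (G.freeGen i) (G.freeGen j))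
  rw [h1, map_zero, freeLie_bracket_gen hG] at h2
  simpa [toU] using h2.symm

/-- The relation `[e_i, e_i] = 0` reads `2 e_i² = 0`. -/
theorem e_mul_self (hG : G.isotropic = Set.univ) (i : I) : G.e i * G.e i = 0 := by
  have h := e_mul_e_add hG (G.graph.loopless.irrefl i)
  rw [← two_smul ℂ] at h
  exact (smul_eq_zero.1 h).resolve_left two_ne_zero

/-- Having equal products up to sign is a congruence on words, and it contains the commutations that
generate the Cartier-Foata congruence. -/
theorem prod_map_eq_or_neg {A : Type*} [Ring A] {f : I → A}
    (hf : ∀ i j, ¬ G.graph.Adj i j → f i * f j + f j * f i = 0) {v w : List I}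
    (h : G.cls v = G.cls w) :
    (v.map f).prod = (w.map f).prod ∨ (v.map f).prod = -(w.map f).prod := by
  let F : FreeMonoid I →* A := FreeMonoid.lift f
  have hF : ∀ w : List I, F (FreeMonoid.ofList w) = (w.map f).prod := fun w => by
    simp [F, FreeMonoid.lift_ofList]
  let c : Con (FreeMonoid I) :=
    { r := fun u v => F u = F v ∨ F u = -F v
      iseqv := ⟨fun _ => Or.inl rfl, by
          rintro u v (h | h)
          · exact Or.inl h.symm
          · exact Or.inr (by rw [h, neg_neg]), by
          rintro u v w (h | h) (h' | h') <;> rw [h, h'] <;> simp⟩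
      mul' := by
        rintro u v u' v' (h | h) (h' | h') <;> simp [h, h'] }
  have hle : conGen (fun u v : FreeMonoid I => ∃ a b, ¬ G.graph.Adj a b ∧
      u = FreeMonoid.of a * FreeMonoid.of b ∧ v = FreeMonoid.of b * FreeMonoid.of a) ≤ c := by
    refine Con.conGen_le.2 ?_
    rintro _ _ ⟨a, b, hab, rfl, rfl⟩
    refine Or.inr ?_
    simpa [F] using eq_neg_of_add_eq_zero_left (hf a b hab)
  have := hle ((Con.eq _).1 h)
  rw [← hF, ← hF]
  exact this

/-- Words of the same class have the same product in the enveloping algebra, up to sign. -/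
theorem prod_e_eq_or_neg (hG : G.isotropic = Set.univ) {v w : List I} (h : G.cls v = G.cls w) :
    (v.map G.e).prod = (w.map G.e).prod ∨ (v.map G.e).prod = -(w.map G.e).prod :=
  prod_map_eq_or_neg (fun _ _ => e_mul_e_add hG) h

theorem prod_e_eq_zero (hG : G.isotropic = Set.univ) {w : List I}
    (h : ¬ G.SquareFree (G.cls w)) : (w.map G.e).prod = 0 := by
  simp only [SquareFree, not_forall, not_not] at h
  obtain ⟨m₁, i, m₂, h⟩ := h
  obtain ⟨v₁, rfl⟩ := G.exists_cls_eq m₁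
  obtain ⟨v₂, rfl⟩ := G.exists_cls_eq m₂
  have h0 : ((v₁ ++ (i :: i :: v₂)).map G.e).prod = 0 := by
    rw [List.map_append, List.prod_append, List.map_cons, List.map_cons, List.prod_cons,
      List.prod_cons, ← mul_assoc (G.e i), e_mul_self hG, zero_mul, mul_zero]
  rcases prod_e_eq_or_neg hG (w := v₁ ++ (i :: i :: v₂)) h with h | h
  · rw [h, h0]
  · rw [h, h0, neg_zero]

/-! ### The universal property of the enveloping algebra -/

section Lift

variable {A : Type*} [Ring A] [Algebra ℂ A]

theorem lift_freeLie_bracket (f : I → A) {p q : ZMod 2} {x y : G.freeLieCarrier}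
    (hx : x.1 ∈ G.freeAssoc.part p) (hy : y.1 ∈ G.freeAssoc.part q) :
    FreeAlgebra.lift ℂ f (G.freeLie.bracket x y).1 =
      FreeAlgebra.lift ℂ f x.1 * FreeAlgebra.lift ℂ f y.1 -
        superSign p q • (FreeAlgebra.lift ℂ f y.1 * FreeAlgebra.lift ℂ f x.1) := by
  rw [coe_freeLie_bracket, G.freeAssoc_bracket hx hy, map_sub, map_smul, map_mul, map_mul]

/-- The target needs no grading: an algebra homomorphism takes the bracket of homogeneous `x`, `y`
to the signed commutator with the parities read off in the source, and this vanishes once the image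
of `y` does. -/
theorem pclsaIdeal_le_ker (hG : G.isotropic = Set.univ) (f : I → A)
    (hf : ∀ i j, ¬ G.graph.Adj i j → f i * f j + f j * f i = 0) : G.pclsaIdeal ≤
    LinearMap.ker ((FreeAlgebra.lift ℂ f).toLinearMap ∘ₗ G.freeLieCarrier.subtype) := by
  refine LieSuperalgebra.idealSpan_le ?_ ?_
  · have key : ∀ i j, ¬ G.graph.Adj i j → G.freeLie.bracket (G.freeGen i) (G.freeGen j) ∈
        LinearMap.ker ((FreeAlgebra.lift ℂ f).toLinearMap ∘ₗ G.freeLieCarrier.subtype) ∧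
        ∃ p, G.freeLie.bracket (G.freeGen i) (G.freeGen j) ∈ G.freeLie.part p := by
      intro i j h
      refine ⟨?_, _, G.freeLie.bracket_mem (G.ι_mem_part i) (G.ι_mem_part j)⟩
      rw [LinearMap.mem_ker, LinearMap.comp_apply, Submodule.subtype_apply,
        freeLie_bracket_gen hG]
      simpa using hf i j h
    rintro _ (⟨i, j, -, h, rfl⟩ | ⟨i, -, rfl⟩)
    · exact key i j h
    · exact key i i (G.graph.loopless.irrefl i)
  · intro p q x y hx hy hK
    have hK' : FreeAlgebra.lift ℂ f y.1 = 0 := hK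
    change FreeAlgebra.lift ℂ f (G.freeLie.bracket x y).1 = 0
    rw [lift_freeLie_bracket f hx hy, hK', zero_mul, mul_zero, smul_zero, sub_zero]

/-- The linear map of the free partially commutative Lie superalgebra to an algebra given by
elements with the defining relations. -/
def pclsaLift (hG : G.isotropic = Set.univ) (f : I → A)
    (hf : ∀ i j, ¬ G.graph.Adj i j → f i * f j + f j * f i = 0) : G.Pclsa →ₗ[ℂ] A :=
  G.pclsaIdeal.liftQ _ (pclsaIdeal_le_ker hG f hf)

theorem pclsaLift_mkQ (hG : G.isotropic = Set.univ) (f : I → A)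
    (hf : ∀ i j, ¬ G.graph.Adj i j → f i * f j + f j * f i = 0) (x : G.freeLieCarrier) :
    pclsaLift hG f hf (G.pclsaIdeal.mkQ x) = FreeAlgebra.lift ℂ f x.1 := rfl

/-- The universal property of the enveloping algebra. -/
def uLift (hG : G.isotropic = Set.univ) (f : I → A)
    (hf : ∀ i j, ¬ G.graph.Adj i j → f i * f j + f j * f i = 0) : G.U →ₐ[ℂ] A :=
  G.pclsa.envLift (pclsaLift hG f hf) (by
    intro p q x y hx hy
    obtain ⟨x, hx', rfl⟩ := G.exists_mkQ_of_mem_part hx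
    obtain ⟨y, hy', rfl⟩ := G.exists_mkQ_of_mem_part hy
    rw [pclsa_bracket_mkQ, pclsaLift_mkQ, pclsaLift_mkQ, pclsaLift_mkQ,
      lift_freeLie_bracket f hx' hy'])

theorem uLift_e (hG : G.isotropic = Set.univ) (f : I → A)
    (hf : ∀ i j, ¬ G.graph.Adj i j → f i * f j + f j * f i = 0) (i : I) :
    uLift hG f hf (G.e i) = f i := by
  rw [e, uLift, LieSuperalgebra.envLift_envι, pclsaLift_mkQ]
  simp [freeGen]

end Lift

/-! ### A representation on the classes -/

section Representation

variable [LinearOrder I]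

variable (G) in
/-- The sign which arises when `i` is moved past the letters smaller than `i`. -/
def moveSign (i : I) : G.CartierFoata →* ℂˣ :=
  G.liftCls (fun j => if j < i then -1 else 1) (fun _ _ _ => mul_comm _ _)

theorem moveSign_letter (i j : I) : G.moveSign i (G.cls [j]) = if j < i then -1 else 1 := by
  simp [moveSign, liftCls_cls]

open Classical in
variable (G) in
/-- The action of `e_i` on the space spanned by the classes. -/
def eOp (i : I) : Module.End ℂ (G.CartierFoata →₀ ℂ) :=
  Finsupp.linearCombination ℂ fun m =>
    if G.SquareFree (G.cls [i] * m) then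
      Finsupp.single (G.cls [i] * m) (G.moveSign i m : ℂ) else 0

open Classical in
theorem eOp_single (i : I) (m : G.CartierFoata) (c : ℂ) : G.eOp i (Finsupp.single m c) =
    if G.SquareFree (G.cls [i] * m) then
      Finsupp.single (G.cls [i] * m) (c * G.moveSign i m) else 0 := by
  rw [eOp, Finsupp.linearCombination_single]
  split_ifs <;> simp

theorem eOp_mul_single (i j : I) (m : G.CartierFoata) (c : ℂ)
    (h : G.SquareFree (G.cls [i] * (G.cls [j] * m))) :
    (G.eOp i * G.eOp j) (Finsupp.single m c) = Finsupp.single (G.cls [i] * (G.cls [j] * m))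
      (c * (G.moveSign i (G.cls [j]) * (G.moveSign i m * G.moveSign j m))) := by
  rw [Module.End.mul_apply, eOp_single, if_pos h.right, eOp_single, if_pos h, map_mul]
  congr 1
  push_cast
  ring

theorem eOp_mul_single_of_not (i j : I) (m : G.CartierFoata) (c : ℂ)
    (h : ¬ G.SquareFree (G.cls [i] * (G.cls [j] * m))) :
    (G.eOp i * G.eOp j) (Finsupp.single m c) = 0 := by
  rw [Module.End.mul_apply, eOp_single]
  split_ifs
  · rw [eOp_single, if_neg h]
  · rw [map_zero]

theorem eOp_mul_eOp_add {i j : I} (h : ¬ G.graph.Adj i j) :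
    G.eOp i * G.eOp j + G.eOp j * G.eOp i = 0 := by
  refine Finsupp.lhom_ext fun m c => ?_
  rw [LinearMap.add_apply, LinearMap.zero_apply]
  have hc : G.cls [j] * (G.cls [i] * m) = G.cls [i] * (G.cls [j] * m) := by
    rw [← mul_assoc, ← mul_assoc, G.cls_comm h]
  by_cases hs : G.SquareFree (G.cls [i] * (G.cls [j] * m))
  · have hij : i ≠ j := by
      rintro rfl
      exact hs 1 i m (by rw [one_mul])
    rw [eOp_mul_single i j m c hs, eOp_mul_single j i m c (hc ▸ hs), hc, ← Finsupp.single_add]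
    rw [moveSign_letter, moveSign_letter]
    -- Exactly one of the two orders picks up the extra `-1` from moving the larger letter past the
    -- smaller one, so the two terms cancel.
    rcases lt_or_gt_of_ne hij with hlt | hlt
    · rw [if_neg hlt.not_gt, if_pos hlt]
      rw [Finsupp.single_eq_zero]
      push_cast
      ring
    · rw [if_neg hlt.not_gt, if_pos hlt]
      rw [Finsupp.single_eq_zero]
      push_cast
      ring
  · rw [eOp_mul_single_of_not i j m c hs, eOp_mul_single_of_not j i m c (hc ▸ hs), add_zero]

/-- The representation of the enveloping algebra on the classes. -/
def uRep (hG : G.isotropic = Set.univ) : G.U →ₐ[ℂ] Module.End ℂ (G.CartierFoata →₀ ℂ) :=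
  uLift hG G.eOp fun _ _ => eOp_mul_eOp_add

theorem uRep_e (hG : G.isotropic = Set.univ) (i : I) : uRep hG (G.e i) = G.eOp i :=
  uLift_e hG _ _ i

/-- Every suffix of the word is again square-free, so no step gives zero, and each contributes a
factor `±1`. -/
theorem uRep_word (hG : G.isotropic = Set.univ) (w : List I) (h : G.SquareFree (G.cls w)) :
    ∃ c : ℂ, c ≠ 0 ∧
      uRep hG (w.map G.e).prod (Finsupp.single 1 1) = Finsupp.single (G.cls w) c := by
  induction w with
  | nil => exact ⟨1, one_ne_zero, by simp [cls_nil]⟩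
  | cons a w ih =>
    rw [cls_cons] at h ⊢
    obtain ⟨c, hc, hw⟩ := ih h.right
    refine ⟨c * G.moveSign a (G.cls w), mul_ne_zero hc (Units.ne_zero _), ?_⟩
    rw [List.map_cons, List.prod_cons, map_mul, Module.End.mul_apply, hw, uRep_e, eOp_single,
      if_pos h]

end Representation

end MarkedGraph

end

noncomputable section

namespace MarkedGraph

variable {I : Type*} {G : MarkedGraph I}

theorem cls_maxWord [LinearOrder I] (m : G.CartierFoata) : G.cls (G.maxWord m) = m :=
  (G.exists_maxWord m).choose_spec.1

/-! ### The basis of the enveloping algebra -/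

/-- The correspondence of reduced classes and elements of the right-angled Coxeter group. -/
def reducedEquiv (hG : G.isotropic = Set.univ) : G.reducedClasses ≃ G.graph.Racg :=
  (Equiv.subtypeEquivRight fun _ => mem_reducedClasses _ hG).trans G.racgEquiv

theorem reducedEquiv_apply (hG : G.isotropic = Set.univ) (m : G.reducedClasses) :
    reducedEquiv hG m = G.toRacg m.1 := rfl

theorem racgWeight_reducedEquiv (hG : G.isotropic = Set.univ) (m : G.reducedClasses) :
    G.graph.racgWeight (reducedEquiv hG m) = G.clsContent m.1 :=
  racgWeight_toRacg ((mem_reducedClasses _ hG).1 m.2)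

theorem prod_racgBasis (w : List I) :
    (w.map fun i => G.graph.racgBasis (G.graph.racgSystem.simple i)).prod =
      G.graph.racgBasis (G.toRacg (G.cls w)) := by
  rw [toRacg_cls, SimpleGraph.racgBasis, CoxeterSystem.wordProd, map_list_prod, List.map_map]
  rfl

section Basis

variable [LinearOrder I]

variable (G) in
/-- The product of the generators along the maximal word of a class. -/
def maxProd (m : G.CartierFoata) : G.U := ((G.maxWord m).map G.e).prod

theorem prod_e_eq_maxProd_or_neg (hG : G.isotropic = Set.univ) (w : List I) :
    (w.map G.e).prod = G.maxProd (G.cls w) ∨ (w.map G.e).prod = -G.maxProd (G.cls w) :=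
  prod_e_eq_or_neg hG (cls_maxWord _).symm

/-- Evaluating the representation at the empty class turns the family into nonzero multiples of
distinct basis vectors. -/
theorem linearIndependent_maxProd (hG : G.isotropic = Set.univ) :
    LinearIndependent ℂ fun m : G.reducedClasses => G.maxProd m.1 := by
  let L : G.U →ₗ[ℂ] G.CartierFoata →₀ ℂ :=
    (LinearMap.applyₗ (Finsupp.single 1 1)) ∘ₗ (uRep hG).toLinearMap
  have hL : ∀ m : G.reducedClasses, ∃ c : ℂˣ,
      L (G.maxProd m.1) = c • Finsupp.single m.1 (1 : ℂ) := by
    rintro ⟨m, hm⟩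
    rw [mem_reducedClasses _ hG] at hm
    obtain ⟨c, hc, h⟩ := uRep_word hG (G.maxWord m) (by rwa [cls_maxWord])
    refine ⟨Units.mk0 c hc, ?_⟩
    rw [cls_maxWord] at h
    change uRep hG _ _ = _
    rw [maxProd, h, Units.smul_def, Units.val_mk0, Finsupp.smul_single, smul_eq_mul, mul_one]
  choose c hc using hL
  refine LinearIndependent.of_comp L ?_
  have h1 : LinearIndependent ℂ fun m : G.CartierFoata => Finsupp.single m (1 : ℂ) := by
    simpa using (Finsupp.basisSingleOne (R := ℂ) (ι := G.CartierFoata)).linearIndependent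
  have h2 := (h1.comp (Subtype.val : G.reducedClasses → _) Subtype.val_injective).units_smul c
  convert h2 using 1
  funext m
  exact hc m

theorem span_maxProd (hG : G.isotropic = Set.univ) :
    ⊤ ≤ Submodule.span ℂ (Set.range fun m : G.reducedClasses => G.maxProd m.1) := by
  rw [← span_words, Submodule.span_le]
  rintro _ ⟨w, rfl⟩
  change (w.map G.e).prod ∈ _
  by_cases h : G.SquareFree (G.cls w)
  · have hm : G.maxProd (G.cls w) ∈
        Submodule.span ℂ (Set.range fun m : G.reducedClasses => G.maxProd m.1) :=
      Submodule.subset_span ⟨⟨G.cls w, (mem_reducedClasses _ hG).2 h⟩, rfl⟩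
    rcases prod_e_eq_maxProd_or_neg hG w with h | h <;> rw [h]
    · exact hm
    · exact Submodule.neg_mem _ hm
  · rw [prod_e_eq_zero hG h]
    exact Submodule.zero_mem _

/-- The basis of the enveloping algebra indexed by the reduced classes. -/
def uBasis (hG : G.isotropic = Set.univ) : Module.Basis G.reducedClasses ℂ G.U :=
  Module.Basis.mk (linearIndependent_maxProd hG) (span_maxProd hG)

theorem uBasis_apply (hG : G.isotropic = Set.univ) (m : G.reducedClasses) :
    uBasis hG m = G.maxProd m.1 := Module.Basis.mk_apply _ _ _

/-- The linear isomorphism of the enveloping algebra and the group algebra. -/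
def uEquiv (hG : G.isotropic = Set.univ) : G.U ≃ₗ[ℂ] MonoidAlgebra ℂ G.graph.Racg :=
  (uBasis hG).equiv (MonoidAlgebra.basis G.graph.Racg ℂ) (reducedEquiv hG)

theorem uEquiv_maxProd (hG : G.isotropic = Set.univ) (m : G.reducedClasses) :
    uEquiv hG (G.maxProd m.1) = G.graph.racgBasis (reducedEquiv hG m) := by
  rw [← uBasis_apply hG, uEquiv, Module.Basis.equiv_apply]
  simp [SimpleGraph.racgBasis]

/-- Both pieces are spanned by monomials. A word gives zero or, up to sign, the basis element of its
class, and the content of the class is the weight of the corresponding group element. -/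
theorem map_uPart (hG : G.isotropic = Set.univ) (μ : I →₀ ℕ) :
    (G.uPart μ).map (uEquiv hG).toLinearMap = G.graph.racgPart μ := by
  rw [uPart_eq, Submodule.map_span, SimpleGraph.racgPart]
  apply le_antisymm
  · refine Submodule.span_le.2 ?_
    rintro _ ⟨_, ⟨w, rfl, rfl⟩, rfl⟩
    change uEquiv hG (w.map G.e).prod ∈ Submodule.span ℂ _
    by_cases h : G.SquareFree (G.cls w)
    · let m : G.reducedClasses := ⟨G.cls w, (mem_reducedClasses _ hG).2 h⟩
      have hm : uEquiv hG (G.maxProd (G.cls w)) ∈ Submodule.span ℂ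
          {a | ∃ v, G.graph.racgWeight v = SimpleGraph.content w ∧ a = G.graph.racgBasis v} := by
        refine Submodule.subset_span ⟨reducedEquiv hG m, ?_, uEquiv_maxProd hG m⟩
        rw [racgWeight_reducedEquiv, clsContent_cls]
      rcases prod_e_eq_maxProd_or_neg hG w with h | h <;> rw [h]
      · exact hm
      · rw [map_neg]
        exact Submodule.neg_mem _ hm
    · rw [prod_e_eq_zero hG h, map_zero]
      exact Submodule.zero_mem _
  · refine Submodule.span_le.2 ?_
    rintro _ ⟨v, rfl, rfl⟩
    obtain ⟨m, rfl⟩ := (reducedEquiv hG).surjective v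
    refine Submodule.subset_span ⟨G.maxProd m.1, ⟨G.maxWord m.1, ?_, rfl⟩, uEquiv_maxProd hG m⟩
    rw [racgWeight_reducedEquiv, ← clsContent_cls, cls_maxWord]

end Basis

theorem racgWeight_wordProd {w : List I} (h : G.graph.racgSystem.IsReduced w) :
    G.graph.racgWeight (G.graph.racgSystem.wordProd w) = SimpleGraph.content w := by
  rw [← toRacg_cls, racgWeight_toRacg (squareFree_of_isReduced h), clsContent_cls]

end MarkedGraph

/-! ### Alternating series -/

section Sign

variable {I : Type*}

/-- The sign `(-1)^{|μ|}`. -/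
def expSign (μ : I →₀ ℕ) : ℂ := μ.prod fun _ k => (-1) ^ k

theorem expSign_add (μ ν : I →₀ ℕ) : expSign (μ + ν) = expSign μ * expSign ν := by
  classical
  exact Finsupp.prod_add_index' (fun _ => pow_zero _) (fun _ _ _ => pow_add _ _ _)

theorem expSign_single (i : I) : expSign (Finsupp.single i 1) = -1 := by
  simp [expSign]

theorem expSign_zero : expSign (0 : I →₀ ℕ) = 1 := by
  simp [expSign]

open Classical in
/-- The sum of the monomials with support `S`, with signs. -/
def alternatingSeries (S : Finset I) : MvPowerSeries I ℂ :=
  fun μ => if μ.support = S then expSign μ else 0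

open Classical in
theorem coeff_alternatingSeries (S : Finset I) (μ : I →₀ ℕ) :
    MvPowerSeries.coeff μ (alternatingSeries S) = if μ.support = S then expSign μ else 0 := rfl

theorem constantCoeff_one_add_X (i : I) :
    MvPowerSeries.constantCoeff (1 + MvPowerSeries.X i : MvPowerSeries I ℂ) ≠ 0 := by
  simp

-- This is `-x/(1+x) = ∑_{k ≥ 1} (-x)^k` in the variable `i`, with the denominator cleared.
open Classical in
theorem alternatingSeries_insert {S : Finset I} {i : I} (hi : i ∉ S) :
    alternatingSeries (insert i S) * (1 + MvPowerSeries.X i) =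
      alternatingSeries S * -MvPowerSeries.X i := by
  ext μ
  rw [mul_add, mul_one, mul_neg, map_add, map_neg, MvPowerSeries.X,
    MvPowerSeries.coeff_mul_monomial, MvPowerSeries.coeff_mul_monomial]
  simp only [mul_one, coeff_alternatingSeries]
  by_cases hμ : Finsupp.single i 1 ≤ μ
  · obtain ⟨ν, rfl⟩ := exists_add_of_le hμ
    rw [if_pos hμ, if_pos hμ, add_tsub_cancel_left, expSign_add, expSign_single]
    have hs : (Finsupp.single i 1 + ν).support = insert i ν.support := by
      ext j
      by_cases hj : j = i
      · subst hj; simp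
      · simp [hj]
    rw [hs]
    -- If `i` occurs at least twice in the monomial, the two terms on the left cancel; if it occurs
    -- once, only the first term remains and matches the right side.
    by_cases hν : i ∈ ν.support
    · have h1 : ν.support ≠ S := fun h => hi (h ▸ hν)
      rw [Finset.insert_eq_of_mem hν, if_neg h1]
      split_ifs <;> ring
    · have h1 : ν.support ≠ insert i S := fun h => hν (h ▸ Finset.mem_insert_self i S)
      have h2 : insert i ν.support = insert i S ↔ ν.support = S := by
        constructor
        · intro h
          rw [← Finset.erase_insert hν, h, Finset.erase_insert hi]
        · intro h; rw [h]
      rw [if_neg h1]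
      simp only [h2]
      split_ifs <;> ring
  · have h1 : μ.support ≠ insert i S := by
      intro h
      have : i ∈ μ.support := h ▸ Finset.mem_insert_self i S
      exact hμ (Finsupp.single_le_iff.2 (Nat.one_le_iff_ne_zero.2 (Finsupp.mem_support_iff.1 this)))
    rw [if_neg hμ, if_neg hμ, if_neg h1, add_zero, neg_zero]

theorem prod_neg_X_mul_inv (S : Finset I) :
    ∏ i ∈ S, (-MvPowerSeries.X i * (1 + MvPowerSeries.X i)⁻¹ : MvPowerSeries I ℂ) =
      alternatingSeries S := by
  classical
  induction S using Finset.induction_on with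
  | empty =>
    rw [Finset.prod_empty]
    ext μ
    simp only [coeff_alternatingSeries, MvPowerSeries.coeff_one, Finsupp.support_eq_empty]
    split_ifs with h
    · rw [h, expSign_zero]
    · rfl
  | insert i S hi ih =>
    rw [Finset.prod_insert hi, ih, mul_comm, ← mul_assoc, ← alternatingSeries_insert hi, mul_assoc,
      MvPowerSeries.mul_inv_cancel _ (constantCoeff_one_add_X i), mul_one]

end Sign

/-! ### The independence series at `-x` -/

namespace MarkedGraph

variable {I : Type*} {G : MarkedGraph I}

variable (G) in
/-- The support of an exponent is independent. -/
def IndepSupport (μ : I →₀ ℕ) : Prop :=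
  ∀ i ∈ μ.support, ∀ j ∈ μ.support, ¬ G.graph.Adj i j

theorem isIndepSet_support {μ : I →₀ ℕ} :
    G.graph.IsIndepSet (μ.support : Set I) ↔ G.IndepSupport μ := by
  constructor
  · intro h i hi j hj hadj
    exact h hi hj hadj.ne hadj
  · intro h i hi j hj _
    exact h i hi j hj

variable (G) in
/-- The independence series at `-x`. -/
abbrev alternatingIndepSeries : MvPowerSeries I ℂ :=
  MvPowerSeries.rescale (fun _ => (-1 : ℂ)) G.indepSeries

open Classical in
theorem coeff_alternatingIndepSeries (hG : G.isotropic = Set.univ) (μ : I →₀ ℕ) :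
    MvPowerSeries.coeff μ G.alternatingIndepSeries =
      if G.IndepSupport μ then expSign μ else 0 := by
  rw [MvPowerSeries.coeff_rescale, MvPowerSeries.coeff_apply, indepSeries]
  simp only [hG, Set.mem_univ, not_true_eq_false, false_implies, implies_true, and_true,
    isIndepSet_support, expSign]
  split_ifs <;> simp

theorem constantCoeff_alternatingIndepSeries (hG : G.isotropic = Set.univ) :
    MvPowerSeries.constantCoeff G.alternatingIndepSeries = 1 := by
  rw [← MvPowerSeries.coeff_zero_eq_constantCoeff_apply, coeff_alternatingIndepSeries hG,
    if_pos (by simp [IndepSupport]), expSign_zero]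

/-- A monomial occurs in the term of its own support and in no other. -/
theorem hasFormalSum_alternatingIndepSeries (hG : G.isotropic = Set.univ) :
    HasFormalSum (fun S : {S : Finset I // G.graph.IsIndepSet (S : Set I)} =>
      ∏ i ∈ S.1, (-MvPowerSeries.X i * (1 + MvPowerSeries.X i)⁻¹)) G.alternatingIndepSeries := by
  classical
  intro μ
  simp only [prod_neg_X_mul_inv, coeff_alternatingSeries]
  constructor
  · refine Set.Subsingleton.finite ?_
    intro S hS T hT
    have hS' : μ.support = S.1 := by
      by_contra h
      exact hS (if_neg h)
    have hT' : μ.support = T.1 := by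
      by_contra h
      exact hT (if_neg h)
    exact Subtype.ext (hS'.symm.trans hT')
  · rw [coeff_alternatingIndepSeries hG]
    split_ifs with h
    · rw [finsum_eq_single _ ⟨μ.support, isIndepSet_support.2 h⟩]
      · rw [if_pos rfl]
      · intro S hS
        exact if_neg fun hh => hS (Subtype.ext hh.symm)
    · refine (finsum_eq_zero_of_forall_eq_zero fun S => if_neg ?_).symm
      intro hS
      exact h (isIndepSet_support.1 (hS ▸ S.2))

/-! ### The Hilbert series -/

variable (G) in
/-- The letters which may be moved between `U` and `m`: those which commute with `U` and either
occur in `U` or are initial in `m`. -/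
def movable (U : I →₀ ℕ) (m : G.CartierFoata) : Set I :=
  {j | (∀ k ∈ U.support, ¬ G.graph.Adj j k) ∧ (j ∈ U.support ∨ G.strip j m ≠ none)}

theorem mem_support_add_single {U : I →₀ ℕ} {i j : I} :
    j ∈ (U + Finsupp.single i 1).support ↔ j ∈ U.support ∨ j = i := by
  classical
  by_cases hj : j = i
  · subst hj; simp
  · simp [hj]

/-- The invariance behind the involution: moving `i` between the multiset and the front of the class
leaves the set of movable letters unchanged. A neighbour of `i` is movable on neither side, since it
fails to commute with `i` in the multiset and is blocked by `i` in the class; for any other `j ≠ i`,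
being initial is not affected by `i`. -/
theorem movable_add_single {U : I →₀ ℕ} {i : I} (hi : ∀ k ∈ U.support, ¬ G.graph.Adj i k)
    (t : G.CartierFoata) :
    G.movable (U + Finsupp.single i 1) t = G.movable U (G.cls [i] * t) := by
  ext j
  simp only [movable, Set.mem_ofPred_eq, mem_support_add_single]
  by_cases hj : j = i
  · subst hj
    simp only [strip_self, or_true, true_or, and_true, ne_eq, reduceCtorEq, not_false_eq_true]
    constructor
    · intro h k hk; exact h k (Or.inl hk)
    · rintro h k (hk | rfl)
      · exact h k hk
      · exact G.graph.loopless.irrefl k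
  · simp only [hj, or_false]
    by_cases hadj : G.graph.Adj i j
    · constructor
      · rintro ⟨h, -⟩
        exact absurd hadj.symm (h i (Or.inr rfl))
      · rintro ⟨-, h | h⟩
        · exact absurd hadj (hi j h)
        · simp [strip_letter_mul, Ne.symm hj, hadj] at h
    · rw [G.strip_of_not_adj (Ne.symm hj) hadj]
      have : Option.map (fun x => G.cls [i] * x) (G.strip j t) ≠ none ↔ G.strip j t ≠ none := by
        simp
      rw [this]
      refine and_congr_left fun _ => ⟨fun h k hk => h k (Or.inl hk), ?_⟩
      rintro h k (hk | rfl)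
      · exact h k hk
      · exact fun h => hadj h.symm

/-- An initial `i` of `m` goes to `U`, even if `U` already contains `i`, since multiplicities are
allowed there. Otherwise `i` lies in `U`, and one copy goes to the front of `m`, where no `i` is
initial. -/
theorem exists_toggle {U : I →₀ ℕ} {m : G.CartierFoata} {i : I} (hU : G.IndepSupport U)
    (hi : i ∈ G.movable U m) :
    ∃ U', U' + G.clsContent (G.toggle i m) = U + G.clsContent m ∧ G.IndepSupport U' ∧
      G.movable U' (G.toggle i m) = G.movable U m ∧ expSign U' = -expSign U := by
  obtain ⟨h1, h2⟩ := hi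
  rcases hs : G.strip i m with _ | t
  · have hiU := h2.resolve_right (not_not.2 hs)
    obtain ⟨V, rfl⟩ : ∃ V, U = V + Finsupp.single i 1 :=
      ⟨U - Finsupp.single i 1, (tsub_add_cancel_of_le (Finsupp.single_le_iff.2
        (Nat.one_le_iff_ne_zero.2 (Finsupp.mem_support_iff.1 hiU)))).symm⟩
    simp only [mem_support_add_single] at h1
    refine ⟨V, ?_, ?_, ?_, ?_⟩
    · rw [toggle_of_none hs, clsContent_mul, clsContent_letter, add_assoc]
    · intro a ha b hb
      exact hU a (mem_support_add_single.2 (Or.inl ha)) b (mem_support_add_single.2 (Or.inl hb))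
    · rw [toggle_of_none hs, movable_add_single fun k hk => h1 k (Or.inl hk)]
    · rw [expSign_add, expSign_single]; ring
  · rw [toggle_of_some hs]
    rw [strip_eq_some_iff] at hs
    subst hs
    refine ⟨U + Finsupp.single i 1, ?_, ?_, ?_, ?_⟩
    · rw [clsContent_mul, clsContent_letter, add_assoc]
    · intro a ha b hb
      rw [mem_support_add_single] at ha hb
      rcases ha with ha | rfl <;> rcases hb with hb | rfl
      · exact hU a ha b hb
      · exact fun h => h1 a ha h.symm
      · exact h1 b hb
      · exact G.graph.loopless.irrefl _
    · exact movable_add_single h1 t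
    · rw [expSign_add, expSign_single]; ring

/-- Any letter of `U` will do, and if `U` is empty, any initial letter of `m`. -/
theorem movable_nonempty {U : I →₀ ℕ} {m : G.CartierFoata} (hU : G.IndepSupport U)
    (h : U + G.clsContent m ≠ 0) : (G.movable U m).Nonempty := by
  by_cases hU0 : U = 0
  · subst hU0
    induction m using cls_induction with
    | one => simp [clsContent_one] at h
    | cons a m _ => exact ⟨a, by simp [movable, strip_self]⟩
  · obtain ⟨i, hi⟩ := Finsupp.support_nonempty_iff.2 hU0
    exact ⟨i, fun k hk => hU i hi k hk, Or.inl hi⟩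

variable (G) in
/-- The square-free classes of given content. -/
def squareFreeFinset (μ : I →₀ ℕ) : Finset G.CartierFoata :=
  ((G.finite_clsContent_eq μ).inter_of_right {m | G.SquareFree m}).toFinset

theorem mem_squareFreeFinset {μ : I →₀ ℕ} {m : G.CartierFoata} :
    m ∈ G.squareFreeFinset μ ↔ G.SquareFree m ∧ G.clsContent m = μ := by
  simp [squareFreeFinset]

variable (G) in
/-- The generating series of the square-free classes by content. -/
def squareFreeSeries : MvPowerSeries I ℂ := fun μ => (G.squareFreeFinset μ).card

theorem coeff_squareFreeSeries (μ : I →₀ ℕ) :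
    MvPowerSeries.coeff μ G.squareFreeSeries = (G.squareFreeFinset μ).card := rfl

theorem hasFormalSum_squareFreeSeries :
    HasFormalSum G.graph.racgMonomial G.squareFreeSeries := by
  classical
  intro μ
  have hsub : {w | MvPowerSeries.coeff μ (G.graph.racgMonomial w) ≠ 0} ⊆
      ((G.squareFreeFinset μ).image G.toRacg : Finset _) := by
    intro w hw
    obtain ⟨m, rfl⟩ := G.racgEquiv.surjective w
    rw [racgEquiv_apply] at hw ⊢
    rw [Set.mem_ofPred_eq, SimpleGraph.racgMonomial, racgWeight_toRacg m.2,
      MvPowerSeries.coeff_monomial] at hw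
    refine Finset.mem_coe.2 (Finset.mem_image_of_mem _ (mem_squareFreeFinset.2 ⟨m.2, ?_⟩))
    by_contra h
    exact hw (if_neg (Ne.symm h))
  refine ⟨(Finset.finite_toSet _).subset hsub, ?_⟩
  rw [finsum_eq_finsetSum_of_support_subset _ hsub, Finset.sum_image, coeff_squareFreeSeries,
    Finset.card_eq_sum_ones, Nat.cast_sum]
  · refine Finset.sum_congr rfl fun m hm => ?_
    obtain ⟨h1, h2⟩ := mem_squareFreeFinset.1 hm
    rw [SimpleGraph.racgMonomial, racgWeight_toRacg h1, h2, MvPowerSeries.coeff_monomial_same,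
      Nat.cast_one]
  · intro m hm n hn h
    have := G.racgEquiv.injective
      (a₁ := ⟨m, (mem_squareFreeFinset.1 hm).1⟩) (a₂ := ⟨n, (mem_squareFreeFinset.1 hn).1⟩) h
    exact congrArg Subtype.val this

/-- In each degree the product is a signed sum over square-free `m` for which the complement `U = μ
- content m` is independent. For `μ ≠ 0` the terms cancel in pairs by moving a letter between `U`
and `m`. -/
theorem squareFreeSeries_mul (hG : G.isotropic = Set.univ) :
    G.squareFreeSeries * G.alternatingIndepSeries = 1 := by
  classical
  ext μ
  let S := (Finset.HasAntidiagonal.antidiagonal μ).biUnion fun p => G.squareFreeFinset p.1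
  have hS : ∀ m, m ∈ S ↔ G.SquareFree m ∧ G.clsContent m ≤ μ := by
    intro m
    simp only [S, Finset.mem_biUnion, mem_squareFreeFinset, Finset.HasAntidiagonal.mem_antidiagonal]
    constructor
    · rintro ⟨p, hp, h1, h2⟩
      exact ⟨h1, h2 ▸ hp ▸ le_self_add⟩
    · rintro ⟨h1, h2⟩
      exact ⟨(G.clsContent m, μ - G.clsContent m), add_tsub_cancel_of_le h2, h1, rfl⟩
  have hsum : MvPowerSeries.coeff μ (G.squareFreeSeries * G.alternatingIndepSeries) =
      ∑ m ∈ S with G.IndepSupport (μ - G.clsContent m), expSign (μ - G.clsContent m) := by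
    rw [MvPowerSeries.coeff_mul, Finset.sum_filter, Finset.sum_biUnion]
    · refine Finset.sum_congr rfl fun p hp => ?_
      rw [Finset.HasAntidiagonal.mem_antidiagonal] at hp
      rw [coeff_squareFreeSeries, coeff_alternatingIndepSeries hG, ← nsmul_eq_mul,
        ← Finset.sum_const]
      refine Finset.sum_congr rfl fun m hm => ?_
      rw [(mem_squareFreeFinset.1 hm).2, ← hp, add_tsub_cancel_left]
    · intro p hp q hq hpq
      refine Finset.disjoint_left.2 fun m hm hm' => hpq ?_
      have h1 : p.1 = q.1 := by
        rw [← (mem_squareFreeFinset.1 hm).2, (mem_squareFreeFinset.1 hm').2]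
      rw [Finset.mem_coe, Finset.HasAntidiagonal.mem_antidiagonal] at hp hq
      exact Prod.ext h1 (add_left_cancel (a := p.1) (by rw [hp, h1, hq]))
  rw [hsum, MvPowerSeries.coeff_one]
  set T := S.filter fun m => G.IndepSupport (μ - G.clsContent m) with hT
  have hmem : ∀ m, m ∈ T ↔ G.SquareFree m ∧
      ∃ U, U + G.clsContent m = μ ∧ G.IndepSupport U := by
    intro m
    rw [hT, Finset.mem_filter, hS, and_assoc]
    refine and_congr_right fun _ => ⟨fun h => ⟨_, tsub_add_cancel_of_le h.1, h.2⟩, ?_⟩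
    rintro ⟨U, rfl, hU⟩
    exact ⟨le_add_self, by rwa [add_tsub_cancel_right]⟩
  split_ifs with hμ
  · subst hμ
    have hT1 : T = {1} := by
      ext m
      rw [hmem, Finset.mem_singleton]
      constructor
      · rintro ⟨-, U, hU, -⟩
        have h0 : G.clsContent m = 0 := (add_eq_zero.1 hU).2
        induction m using cls_induction with
        | one => rfl
        | cons a m _ =>
          rw [clsContent_mul, clsContent_letter, add_eq_zero] at h0
          simp at h0
      · rintro rfl
        exact ⟨squareFree_one, 0, by rw [clsContent_one, add_zero], by simp [IndepSupport]⟩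
    rw [hT1, Finset.sum_singleton, clsContent_one, tsub_zero, expSign_zero]
  · obtain ⟨i₀, -⟩ := Finsupp.support_nonempty_iff.2 hμ
    -- The letter is chosen as a function of the movable set alone. That set is the same before and
    -- after the move, so the second move picks the same letter and undoes the first.
    obtain ⟨pick, hpick⟩ : ∃ pick : Set I → I, ∀ s : Set I, s.Nonempty → pick s ∈ s := by
      refine ⟨fun s => if h : s.Nonempty then h.some else i₀, fun s h => ?_⟩
      simp only [dif_pos h]
      exact h.some_mem
    let flip : G.CartierFoata → G.CartierFoata := fun m =>
      G.toggle (pick (G.movable (μ - G.clsContent m) m)) m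
    have hflip : ∀ m ∈ T, flip m ∈ T ∧ flip (flip m) = m ∧
        expSign (μ - G.clsContent (flip m)) = -expSign (μ - G.clsContent m) := by
      intro m hm
      obtain ⟨hsf, U, hU, hind⟩ := (hmem m).1 hm
      have hsub : μ - G.clsContent m = U := by rw [← hU, add_tsub_cancel_right]
      have hi := hpick _ (movable_nonempty hind (hU ▸ hμ))
      obtain ⟨U', h1, h2, h3, h4⟩ := exists_toggle hind hi
      have hf : flip m = G.toggle (pick (G.movable U m)) m := by simp only [flip, hsub]
      have hsub' : μ - G.clsContent (flip m) = U' := by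
        rw [← hU, ← h1, hf, add_tsub_cancel_right]
      refine ⟨(hmem _).2 ⟨hf ▸ hsf.toggle, U', by rw [hf, h1, hU], h2⟩, ?_, ?_⟩
      · have : flip (flip m) = G.toggle (pick (G.movable U' (flip m))) (flip m) := by
          simp only [flip, hsub] at hsub' ⊢
          rw [hsub']
        rw [this, hf, h3, hsf.toggle_toggle]
      · rw [hsub', hsub, h4]
    refine Finset.sum_involution (fun m _ => flip m) ?_ ?_ (fun m hm => (hflip m hm).1)
      (fun m hm => (hflip m hm).2.1)
    · intro m hm
      rw [(hflip m hm).2.2, add_neg_cancel]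
    -- A fixed point would have a term equal to its own negative.
    · intro m hm hne heq
      have := (hflip m hm).2.2
      rw [heq, self_eq_neg] at this
      exact hne this

end MarkedGraph

end

theorem mainTheorem5 {I : Type*} [Countable I] [LinearOrder I] (G : MarkedGraph I)
    (hG : G.isotropic = Set.univ) :
    -- the elements `e_w`, for the maximal words `w` of the reduced classes, form a basis of `U`,
    -- and `e_{i_1} ⋯ e_{i_k} ↦ e(s_{i_1}) ⋯ e(s_{i_k})` on it is a graded isomorphism
    (∃ b : Module.Basis G.reducedClasses ℂ G.U,
      (∀ m, b m = ((G.maxWord m.1).map G.e).prod) ∧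
      ∃ φ : G.U ≃ₗ[ℂ] MonoidAlgebra ℂ G.graph.Racg,
        (∀ m, φ (b m) = ((G.maxWord m.1).map fun i =>
          G.graph.racgBasis (G.graph.racgSystem.simple i)).prod) ∧
        ∀ μ : I →₀ ℕ, (G.uPart μ).map φ.toLinearMap = G.graph.racgPart μ) ∧
    -- `x(w)` does not depend on the reduced expression
    (∀ w : List I, G.graph.racgSystem.IsReduced w →
      G.graph.racgWeight (G.graph.racgSystem.wordProd w) = SimpleGraph.content w) ∧
    -- the Hilbert series
    ∃ H J : MvPowerSeries I ℂ,
      HasFormalSum G.graph.racgMonomial H ∧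
      HasFormalSum (fun S : {S : Finset I // G.graph.IsIndepSet (S : Set I)} =>
        ∏ i ∈ S.1, (-MvPowerSeries.X i * (1 + MvPowerSeries.X i)⁻¹)) J ∧
      H = (MvPowerSeries.rescale (fun _ => (-1 : ℂ)) G.indepSeries)⁻¹ ∧
      (MvPowerSeries.rescale (fun _ => (-1 : ℂ)) G.indepSeries)⁻¹ = J⁻¹ := by

  -- The formal sum over independent sets is taken to be the independence series at `-x` itself, so
  -- the last equality is `rfl`.
  refine ⟨⟨MarkedGraph.uBasis hG, MarkedGraph.uBasis_apply hG, MarkedGraph.uEquiv hG, ?_,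
    MarkedGraph.map_uPart hG⟩, fun w => MarkedGraph.racgWeight_wordProd,
    G.squareFreeSeries, G.alternatingIndepSeries, MarkedGraph.hasFormalSum_squareFreeSeries,
    MarkedGraph.hasFormalSum_alternatingIndepSeries hG, ?_, rfl⟩
  · intro m
    rw [MarkedGraph.uBasis_apply, MarkedGraph.uEquiv_maxProd, MarkedGraph.prod_racgBasis,
      MarkedGraph.cls_maxWord, MarkedGraph.reducedEquiv_apply]
  · rw [MvPowerSeries.eq_inv_iff_mul_eq_one]
    · exact MarkedGraph.squareFreeSeries_mul hG
    · rw [MarkedGraph.constantCoeff_alternatingIndepSeries hG]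
      exact one_ne_zero
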